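/- Let $X$ be a topological space and let $\mathcal H=(\mathcal H_j)_{j\ge 0}$ be a sheaf of AQ normal series on $X$: a sheaf of groups $\mathcal G=\mathcal H_0$ with a descending sequence $\mathcal H_0\supseteq\mathcal H_1\supseteq\mathcal H_2\supseteq\cdots$ of sheaves of normal subgroups of $\mathcal G$ such that every quotient sheaf $\mathcal A_j=\mathcal H_j/\mathcal H_{j+1}$ is abelian. Suppose that $\mathcal H$ has AQ degree $2$, i.e. that also every quotient sheaf $\mathcal H_j/\mathcal H_{j+2}$ is abelian. Then: (1) $\mathcal H$ is central: for every $j>0$ there is some $k<j$ such that $\mathcal A_j$ lies in the centre of $\mathcal H_k/\mathcal H_{j+1}$; and for every $j\ge0$ the sequence of sheaves of abelian groups $0\to\mathcal A_{j+1}\to\mathcal H_j/\mathcal H_{j+2}\to\mathcal A_j\to0$ is exact. (2) Let $j\ge0$ and let $k\le j$ be any index for which $1\to\mathcal A_{j+1}\to\mathcal H_k/\mathcal H_{j+2}\to\mathcal H_k/\mathcal H_{j+1}\to1$ is central. The compositions of set-theoretic maps $$\partial^1\colon H^0(X,\mathcal A_j)\to H^0(X,\mathcal H_k/\mathcal H_{j+1})\xrightarrow{\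 \delta^1\ }H^1(X,\mathcal A_{j+1}),\qquad \partial^2\colon H^1(X,\mathcal A_j)\to \check H^1(X,\mathcal H_k/\mathcal H_{j+1})\xrightarrow{\ \delta^2\ }H^2(X,\mathcal A_{j+1}),$$ where the first maps are induced by $\mathcal A_j\subseteq\mathcal H_k/\mathcal H_{j+1}$ and $\delta^1,\delta^2$ are the connecting maps in nonabelian cohomology of this central extension, are well defined and equal to the connecting homomorphisms in sheaf cohomology of $0\to\mathcal A_{j+1}\to\mathcal H_j/\mathcal H_{j+2}\to\mathcal A_j\to0$. In particular they do not depend on $k$. (3) Hence the primary complex of $\mathcal H$, $$H^0(X,\mathcal A[-1])\xrightarrow{\ \partial^1\ }H^1(X,\mathcal A)\xrightarrow{\ \partial^2\ }H^2(X,\mathcal A[1]),$$ whose component in degree $j$ is $H^0(X,\mathcal A_{j-1})\to H^1(X,\mathcal A_j)\to H^2(X,\mathcal A_{j+1})$ (with $\mathcal A_i=0$ for $i<0$), is a complex of linear maps: $\partial^1$ and $\partial^2$ are homomorphisms of abelian groups and $\partial^2\partial^1=0$. Moreover, if $K$ is a ring (for instance a field) acting on the sheaves $\mathcal A_j$ and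 $\mathcal H_j/\mathcal H_{j+2}$, $j\ge0$, in such a way that all sequences $0\to\mathcal A_{j+1}\to\mathcal H_j/\mathcal H_{j+2}\to\mathcal A_j\to0$ are sequences of sheaves of $K$-modules, then $\partial^1$ and $\partial^2$ are $K$-linear. -/

import Mathlib

open CategoryTheory TopologicalSpace Opposite

universe u v

namespace AQ

noncomputable section

/-! ## Sheaves of groups on a topological space -/

instance : Limits.HasFilteredColimits GrpCat.{u} where
  HasColimitsOfShape _ _ _ :=
    ⟨fun F => ⟨⟨_, GrpCat.FilteredColimits.colimitCoconeIsColimit.{u, u} F⟩⟩⟩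

/-- Sheaves of (not necessarily commutative) groups on `X`. -/
abbrev GroupSheaf (X : TopCat.{u}) := Sheaf (Opens.grothendieckTopology X) GrpCat.{u}

/-- Sheaves of abelian groups on `X`. -/
abbrev AbSheaf (X : TopCat.{u}) := Sheaf (Opens.grothendieckTopology X) AddCommGrpCat.{u}

variable {X : TopCat.{u}}

/-- A sheaf of groups is abelian if all its groups of sections are commutative. -/
def IsAbelian (F : GroupSheaf X) : Prop :=
  ∀ (U : (Opens X)ᵒᵖ) (a b : F.obj.obj U), a * b = b * a

/-- The sections of an abelian sheaf of groups, as an additive abelian group. -/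
abbrev sectionsAddCommGroup (F : GroupSheaf X) (hF : IsAbelian F) (U : (Opens X)ᵒᵖ) :
    AddCommGroup (Additive (F.obj.obj U)) :=
  { (inferInstance : AddGroup (Additive (F.obj.obj U))) with
    add_comm := fun a b => congrArg Additive.ofMul (hF U a.toMul b.toMul) }

/-- The presheaf of additive abelian groups underlying an abelian sheaf of groups. -/
def additivePresheaf (F : GroupSheaf X) (hF : IsAbelian F) :
    (Opens X)ᵒᵖ ⥤ AddCommGrpCat.{u} where
  obj U := @AddCommGrpCat.of (Additive (F.obj.obj U)) (sectionsAddCommGroup F hF U)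
  map {U V} f :=
    letI := sectionsAddCommGroup F hF U
    letI := sectionsAddCommGroup F hF V
    AddCommGrpCat.ofHom (MonoidHom.toAdditive (F.obj.map f).hom)
  map_id U := by
    apply AddCommGrpCat.hom_ext
    apply AddMonoidHom.ext
    intro x
    exact ConcreteCategory.congr_hom (F.obj.map_id U) (Additive.toMul (α := F.obj.obj U) x)
  map_comp {U _ _} f g := by
    apply AddCommGrpCat.hom_ext
    apply AddMonoidHom.ext
    intro x
    exact ConcreteCategory.congr_hom (F.obj.map_comp f g) (Additive.toMul (α := F.obj.obj U) x)

/-- An abelian sheaf of groups, written additively. -/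
def additive (F : GroupSheaf X) (hF : IsAbelian F) : AbSheaf X where
  obj := additivePresheaf F hF
  property :=
    (Presheaf.isSheaf_iff_isSheaf_comp _ (additivePresheaf F hF)
      (forget AddCommGrpCat.{u})).2
      ((Presheaf.isSheaf_iff_isSheaf_comp _ F.obj (forget GrpCat.{u})).1 F.property)

/-- A morphism of abelian sheaves of groups, written additively. -/
def additiveMap {F F' : GroupSheaf X} (hF : IsAbelian F) (hF' : IsAbelian F') (f : F ⟶ F') :
    additive F hF ⟶ additive F' hF' where
  hom :=
    { app U :=
        letI := sectionsAddCommGroup F hF U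
        letI := sectionsAddCommGroup F' hF' U
        AddCommGrpCat.ofHom (MonoidHom.toAdditive (f.hom.app U).hom)
      naturality U V g := by
        ext x
        exact congrArg Additive.ofMul
          (ConcreteCategory.congr_hom (f.hom.naturality g) (Additive.toMul (α := F.obj.obj U) x)) }

/-- The section of the additive sheaf given by a section of the sheaf of groups. -/
def toAdd {F : GroupSheaf X} (hF : IsAbelian F) {U : Opens X} (a : F.obj.obj (op U)) :
    (additive F hF).obj.obj (op U) :=
  Additive.ofMul a

/-- The section of the sheaf of groups given by a section of the additive sheaf. -/
def ofAdd {F : GroupSheaf X} (hF : IsAbelian F) {U : Opens X}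
    (a : (additive F hF).obj.obj (op U)) : F.obj.obj (op U) :=
  Additive.toMul (α := F.obj.obj (op U)) a

/-! ## Normal series of sheaves of groups -/

/-- A descending sequence `G = H 0 ⊇ H 1 ⊇ H 2 ⊇ ⋯` of sheaves of normal subgroups of a sheaf of
groups `G`. -/
structure NormalSeries (X : TopCat.{u}) where
  /-- the ambient sheaf of groups -/
  G : GroupSheaf X
  /-- the sections of the `j`-th term -/
  H : ℕ → ∀ U : (Opens X)ᵒᵖ, Subgroup (G.obj.obj U)
  /-- each term is stable under restriction -/
  map_mem : ∀ (j : ℕ) {U V : (Opens X)ᵒᵖ} (f : U ⟶ V) {s : G.obj.obj U},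
    s ∈ H j U → G.obj.map f s ∈ H j V
  /-- each term is a subsheaf: a section which locally belongs to it belongs to it -/
  mem_of_local : ∀ (j : ℕ) (U : Opens X) (s : G.obj.obj (op U)),
    (∀ x ∈ U, ∃ (V : Opens X) (i : V ⟶ U), x ∈ V ∧ G.obj.map i.op s ∈ H j (op V)) →
      s ∈ H j (op U)
  zero_eq_top : ∀ U, H 0 U = ⊤
  succ_le : ∀ j U, H (j + 1) U ≤ H j U
  normal : ∀ j U, (H j U).Normal

namespace NormalSeries

variable (H : NormalSeries X)

lemma antitone (U : (Opens X)ᵒᵖ) : Antitone fun j => H.H j U :=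
  antitone_nat_of_succ_le fun j => H.succ_le j U

instance (k m : ℕ) (U : (Opens X)ᵒᵖ) : ((H.H m U).subgroupOf (H.H k U)).Normal :=
  have := H.normal m U
  inferInstance

/-- Restriction of sections of the `j`-th term. -/
def restrict (j : ℕ) {U V : (Opens X)ᵒᵖ} (f : U ⟶ V) : H.H j U →* H.H j V :=
  ((H.G.obj.map f).hom.comp (H.H j U).subtype).codRestrict (H.H j V)
    fun s => H.map_mem j f s.2

/-- The presheaf `U ↦ H k (U) / H m (U)` (for `k ≤ m`). -/
def quotPresheaf (k m : ℕ) : (Opens X)ᵒᵖ ⥤ GrpCat.{u} where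
  obj U := GrpCat.of (H.H k U ⧸ (H.H m U).subgroupOf (H.H k U))
  map {U V} f := GrpCat.ofHom
    (QuotientGroup.map _ _ (H.restrict k f) fun s hs => H.map_mem m f (s := s.1) hs)
  map_id U := by
    ext s
    exact congrArg (QuotientGroup.mk (s := (H.H m U).subgroupOf (H.H k U)))
      (Subtype.ext (ConcreteCategory.congr_hom (H.G.obj.map_id U) s.1))
  map_comp {U V W} f g := by
    ext s
    exact congrArg (QuotientGroup.mk (s := (H.H m W).subgroupOf (H.H k W)))
      (Subtype.ext (ConcreteCategory.congr_hom (H.G.obj.map_comp f g) s.1))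

/-- The natural homomorphisms `H k / H m → H k' / H m'`, for `k' ≤ k` and `m' ≤ m`,
on presheaf quotients. -/
def quotPresheafMap {k m k' m' : ℕ} (hk : k' ≤ k) (hm : m' ≤ m) :
    H.quotPresheaf k m ⟶ H.quotPresheaf k' m' where
  app U := GrpCat.ofHom
    (QuotientGroup.map _ _ (Subgroup.inclusion (H.antitone U hk))
      fun s hs => H.antitone U hm (show s.1 ∈ H.H m U from hs))
  naturality U V f := by
    ext s
    obtain ⟨s, rfl⟩ := QuotientGroup.mk_surjective s
    rfl

/-- The quotient sheaf `H k / H m` (for `k ≤ m`). -/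
def quot (k m : ℕ) : GroupSheaf X :=
  (presheafToSheaf _ _).obj (H.quotPresheaf k m)

/-- The natural morphisms of quotient sheaves `H k / H m ⟶ H k' / H m'`, for `k' ≤ k` and
`m' ≤ m`: induced by inclusion of numerators and of denominators. -/
def quotMap {k m k' m' : ℕ} (hk : k' ≤ k) (hm : m' ≤ m) : H.quot k m ⟶ H.quot k' m' :=
  (presheafToSheaf _ _).map (H.quotPresheafMap hk hm)

lemma quotMap_comp {k m k' m' k'' m'' : ℕ} (hk : k' ≤ k) (hm : m' ≤ m) (hk' : k'' ≤ k')
    (hm' : m'' ≤ m') :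
    H.quotMap hk hm ≫ H.quotMap hk' hm' = H.quotMap (hk'.trans hk) (hm'.trans hm) := by
  refine ((presheafToSheaf _ _).map_comp _ _).symm.trans (congrArg _ ?_)
  ext U s
  obtain ⟨s, rfl⟩ := QuotientGroup.mk_surjective
    (s := (H.H m U).subgroupOf (H.H k U)) s
  rfl

/-- AQ degree `d`: all quotients `H j / H (j + 1), …, H j / H (j + d)` are abelian. -/
def HasAQDegree (d : ℕ) : Prop :=
  ∀ j i : ℕ, 1 ≤ i → i ≤ d → IsAbelian (H.quot j (j + i))

/-- For `k < j`, the subsheaf `H j / H (j + 1)` is contained in the centre of `H k / H (j + 1)`. -/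
def CentralAt (k j : ℕ) (hk : k < j) : Prop :=
  ∀ (U : (Opens X)ᵒᵖ) (a : (H.quot j (j + 1)).obj.obj U) (b : (H.quot k (j + 1)).obj.obj U),
    (H.quotMap hk.le le_rfl).hom.app U a * b = b * (H.quotMap hk.le le_rfl).hom.app U a

end NormalSeries

/-- A sheaf of AQ normal series: the successive quotients are abelian. -/
structure AQNormalSeries (X : TopCat.{u}) extends NormalSeries X where
  aq : ∀ j, IsAbelian (toNormalSeries.quot j (j + 1))

namespace AQNormalSeries

variable (H : AQNormalSeries X)

/-- `H` is central if for each `j > 0` the subsheaf `H j / H (j + 1)` is central in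
`H k / H (j + 1)` for some `k < j`. -/
def IsCentral : Prop :=
  ∀ j : ℕ, 0 < j → ∃ (k : ℕ) (hk : k < j), H.CentralAt k j hk

/-- The degree `j` component `A j = H j / H (j + 1)` of the linearisation of `H`. (The components
of negative degree are zero.) -/
def A (j : ℕ) : AbSheaf X := additive (H.quot j (j + 1)) (H.aq j)

lemma quotMap_trivial (j : ℕ) (U : (Opens X)ᵒᵖ) (a : (H.quot (j + 1) (j + 2)).obj.obj U) :
    (H.quotMap (Nat.le_succ j) (Nat.le_succ (j + 1))).hom.app U a = 1 := by
  let t : (H.quot (j + 1) (j + 2)).obj ⟶ (H.quot j (j + 1)).obj :=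
    { app := fun V => GrpCat.ofHom 1
      naturality := fun V W f => by
        ext s
        exact (map_one ((H.quot j (j + 1)).obj.map f).hom).symm }
  have key : (H.quotMap (Nat.le_succ j) (Nat.le_succ (j + 1))).hom = t := by
    refine sheafify_hom_ext (Opens.grothendieckTopology X)
      (P := H.quotPresheaf (j + 1) (j + 2)) _ _ (H.quot j (j + 1)).property ?_
    refine (toSheafify_naturality (Opens.grothendieckTopology X)
      (H.quotPresheafMap (Nat.le_succ j) (Nat.le_succ (j + 1)))).symm.trans ?_
    ext V s
    obtain ⟨s, rfl⟩ := QuotientGroup.mk_surjective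
      (s := (H.H (j + 2) V).subgroupOf (H.H (j + 1) V)) s
    have hs : (H.quotPresheafMap (Nat.le_succ j) (Nat.le_succ (j + 1))).app V
        (QuotientGroup.mk s) = 1 :=
      (QuotientGroup.eq_one_iff _).2 s.2
    refine (congrArg ((toSheafify (Opens.grothendieckTopology X)
      (H.quotPresheaf j (j + 1))).app V) hs).trans ?_
    exact map_one ((toSheafify (Opens.grothendieckTopology X)
      (H.quotPresheaf j (j + 1))).app V).hom
  rw [key]
  rfl

/-- For a series of AQ degree `2`: the sequence `0 ⟶ A (j + 1) ⟶ H j / H (j + 2) ⟶ A j ⟶ 0` of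
sheaves of abelian groups. -/
def extension (hH : H.HasAQDegree 2) (j : ℕ) : ShortComplex (AbSheaf X) where
  X₁ := H.A (j + 1)
  X₂ := additive (H.quot j (j + 2)) (hH j 2 one_le_two le_rfl)
  X₃ := H.A j
  f := additiveMap _ _ (H.quotMap (Nat.le_succ j) le_rfl)
  g := additiveMap _ _ (H.quotMap le_rfl (Nat.le_succ (j + 1)))
  zero := by
    ext U a
    refine Eq.trans ?_ (H.quotMap_trivial j U (Additive.toMul (α := (H.quot _ _).obj.obj U) a))
    rw [← H.quotMap_comp (Nat.le_succ j) le_rfl le_rfl (Nat.le_succ (j + 1))]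
    rfl

end AQNormalSeries

/-! ## Cohomology

`F.H n` is the sheaf cohomology group `H^n(X, F)` of an abelian sheaf `F`. -/

/-- The connecting homomorphism `H^n(X, S.X₃) → H^(n+1)(X, S.X₁)` of a short exact sequence `S` of
abelian sheaves. -/
def connecting {S : ShortComplex (AbSheaf X)} (hS : S.ShortExact) (n : ℕ) :
    Sheaf.H S.X₃ n →+ Sheaf.H S.X₁ (n + 1) :=
  hS.extClass.postcomp _ rfl

/-- Degree zero cohomology is the group of global sections. -/
def globalSections (F : AbSheaf X) : Sheaf.H F 0 ≃+ F.obj.obj (op ⊤) :=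
  Sheaf.H.equiv₀ F Limits.isTerminalTop

/-- A (nonabelian) Čech `1`-cocycle of a sheaf of groups, on some open covering of `X`:
sections `c i j` over `U i ∩ U j` (restricted to all smaller open sets) with
`c i j * c j k = c i k`. -/
structure CechCocycle (F : GroupSheaf X) where
  I : Type u
  U : I → Opens X
  covers : ∀ x : X, ∃ i, x ∈ U i
  toOneCocycle : PresheafOfGroups.OneCocycle F.obj U

namespace CechCocycle

/-- Two cocycles are cohomologous if on some common refinement of their coverings there is a
`0`-cochain `α` with `α k * c k l = d k l * α l`. -/
def Cohomologous {F : GroupSheaf X} (c d : CechCocycle F) : Prop :=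
  ∃ (K : Type u) (W : K → Opens X) (_ : ∀ x : X, ∃ k, x ∈ W k)
    (r : K → c.I) (r' : ∀ k, W k ⟶ c.U (r k)) (s : K → d.I) (s' : ∀ k, W k ⟶ d.U (s k))
    (α : ∀ k, F.obj.obj (op (W k))),
    ∀ (k l : K) ⦃T : Opens X⦄ (a : T ⟶ W k) (b : T ⟶ W l),
      F.obj.map a.op (α k) * c.toOneCocycle.ev (r k) (r l) (a ≫ r' k) (b ≫ r' l) =
        d.toOneCocycle.ev (s k) (s l) (a ≫ s' k) (b ≫ s' l) * F.obj.map b.op (α l)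

/-- The image of a cocycle under a morphism of sheaves of groups. -/
def map {F F' : GroupSheaf X} (f : F ⟶ F') (c : CechCocycle F) : CechCocycle F' where
  I := c.I
  U := c.U
  covers := c.covers
  toOneCocycle :=
    { ev := fun i j T a b => f.hom.app (op T) (c.toOneCocycle.ev i j a b)
      ev_precomp := fun i j T T' φ a b => by
        rw [← c.toOneCocycle.ev_precomp i j φ a b]
        exact (ConcreteCategory.congr_hom (f.hom.naturality φ.op) _).symm
      ev_trans := fun i j k T a b d => by
        rw [← c.toOneCocycle.ev_trans i j k a b d]
        exact (map_mul (f.hom.app (op T)).hom _ _).symm }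

end CechCocycle

/-- The nonabelian Čech cohomology set `Ȟ^1(X, F)`. -/
def CechH1 (F : GroupSheaf X) : Type (u + 1) :=
  Quot (CechCocycle.Cohomologous (F := F))

/-- The class in `Ȟ^1(X, F)` of a cocycle. -/
def CechCocycle.class {F : GroupSheaf X} (c : CechCocycle F) : CechH1 F :=
  Quot.mk _ c

/-- The identification `Ȟ^1(X, F) = H^1(X, F)` for an abelian sheaf `F`: the family `γ` of sections
`γ i j` over `U i ∩ U j` is a Čech cocycle with class `x ∈ H^1(X, F)`. That is: for some short exact
sequence `0 ⟶ F ⟶ J ⟶ Q ⟶ 0` and some global section `q` of `Q` with local lifts `s i` to `J`,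
one has `γ i j = s i - s j`, and `x` is the image of `q` under the connecting homomorphism. -/
def IsCechClass (F : AbSheaf X) {I : Type u} (U : I → Opens X)
    (γ : ∀ (i j : I) ⦃T : Opens X⦄ (_ : T ⟶ U i) (_ : T ⟶ U j), F.obj.obj (op T))
    (x : Sheaf.H F 1) : Prop :=
  ∃ (J Q : AbSheaf X) (f : F ⟶ J) (g : J ⟶ Q) (w : f ≫ g = 0)
    (hS : (ShortComplex.mk f g w).ShortExact)
    (q : Q.obj.obj (op ⊤)) (s : ∀ i, J.obj.obj (op (U i))),
    (∀ i, g.hom.app (op (U i)) (s i) = Q.obj.map (homOfLE le_top).op q) ∧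
    (∀ (i j : I) ⦃T : Opens X⦄ (a : T ⟶ U i) (b : T ⟶ U j),
      f.hom.app (op T) (γ i j a b) = J.obj.map a.op (s i) - J.obj.map b.op (s j)) ∧
    x = connecting hS 0 ((globalSections Q).symm q)

/-- A cocycle of an abelian sheaf of groups has class `x` in sheaf cohomology. -/
def CechCocycle.HasClass {F : GroupSheaf X} (γ : CechCocycle F) (hF : IsAbelian F)
    (x : Sheaf.H (additive F hF) 1) : Prop :=
  IsCechClass (additive F hF) γ.U (fun i j _ a b => toAdd hF (γ.toOneCocycle.ev i j a b)) x

/-- For an exact sequence `1 ⟶ A ⟶ B ⟶ C ⟶ 1` of sheaves of groups with `A` abelian: the class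
`y ∈ H^1(X, A)` is the image of the global section `c` of `C` under the connecting map
`δ^1 : H^0(X, C) → H^1(X, A)`, i.e. it is the class of `(g i * (g j)⁻¹)` for local lifts `g i` of `c`
to `B`. -/
def IsDeltaOne {A B C : GroupSheaf X} (ι : A ⟶ B) (p : B ⟶ C) (hA : IsAbelian A)
    (c : C.obj.obj (op ⊤)) (y : Sheaf.H (additive A hA) 1) : Prop :=
  ∃ (γ : CechCocycle A) (g : ∀ i, B.obj.obj (op (γ.U i))),
    (∀ i, p.hom.app (op (γ.U i)) (g i) = C.obj.map (homOfLE le_top).op c) ∧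
    (∀ (i j : γ.I) ⦃T : Opens X⦄ (a : T ⟶ γ.U i) (b : T ⟶ γ.U j),
      ι.hom.app (op T) (γ.toOneCocycle.ev i j a b) =
        B.obj.map a.op (g i) * (B.obj.map b.op (g j))⁻¹) ∧
    γ.HasClass hA y

/-- For an exact sequence `1 ⟶ A ⟶ B ⟶ C ⟶ 1` of sheaves of groups with `A` central in `B`: the
class `y ∈ H^2(X, A)` is the image of `h ∈ Ȟ^1(X, C)` under the connecting map
`δ^2 : Ȟ^1(X, C) → H^2(X, A)`.

If `h` is the class of `(c i j)` and if `β i j` are lifts of `c i j` to `B`, this is the class of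
the `2`-cocycle `a i j k = β i j * β j k * (β i k)⁻¹` of `A`. On a general space the lifts exist only
locally on `U i ∩ U j`, so that all local lifts are considered simultaneously, and the class is
computed by an embedding of `A` in an abelian sheaf `J` with quotient `Q` in which the cocycle
becomes a coboundary: to every local lift `β` of `c i j` is assigned a local section `φ i j β` of
`J` (only its values on lifts matter), equivariantly for `A` and with
`φ i j β + φ j k β' = φ i k (β * β')`. In particular `φ i j β + φ j k β' - φ i k β''` is
`β * β' * β''⁻¹ ∈ A` for lifts `β, β', β''` of `c i j, c j k, c i k`. The image of `φ i j β` in `Q`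
does not depend on `β`; these images form a `1`-cocycle `q` of `Q`, and `y` is the image of its class
under the connecting homomorphism `H^1(X, Q) → H^2(X, A)`. -/
def IsDeltaTwo {A B C : GroupSheaf X} (ι : A ⟶ B) (p : B ⟶ C) (hA : IsAbelian A)
    (h : CechH1 C) (y : Sheaf.H (additive A hA) 2) : Prop :=
  ∃ (c : CechCocycle C) (_ : c.class = h)
    (J Q : AbSheaf X) (f : additive A hA ⟶ J) (g : J ⟶ Q) (w : f ≫ g = 0)
    (hS : (ShortComplex.mk f g w).ShortExact)
    (φ : ∀ (i j : c.I) ⦃T : Opens X⦄ (_ : T ⟶ c.U i) (_ : T ⟶ c.U j),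
      B.obj.obj (op T) → J.obj.obj (op T))
    (q : ∀ (i j : c.I) ⦃T : Opens X⦄ (_ : T ⟶ c.U i) (_ : T ⟶ c.U j), Q.obj.obj (op T))
    (z : Sheaf.H Q 1),
    (∀ (i j : c.I) ⦃T T' : Opens X⦄ (t : T' ⟶ T) (a : T ⟶ c.U i) (b : T ⟶ c.U j)
      (β : B.obj.obj (op T)), p.hom.app (op T) β = c.toOneCocycle.ev i j a b →
        φ i j (t ≫ a) (t ≫ b) (B.obj.map t.op β) = J.obj.map t.op (φ i j a b β)) ∧
    (∀ (i j : c.I) ⦃T : Opens X⦄ (a : T ⟶ c.U i) (b : T ⟶ c.U j)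
      (α : A.obj.obj (op T)) (β : B.obj.obj (op T)),
      p.hom.app (op T) β = c.toOneCocycle.ev i j a b →
        φ i j a b (ι.hom.app (op T) α * β) = f.hom.app (op T) (toAdd hA α) + φ i j a b β) ∧
    (∀ (i j k : c.I) ⦃T : Opens X⦄ (a : T ⟶ c.U i) (b : T ⟶ c.U j) (d : T ⟶ c.U k)
      (β β' : B.obj.obj (op T)), p.hom.app (op T) β = c.toOneCocycle.ev i j a b →
        p.hom.app (op T) β' = c.toOneCocycle.ev j k b d →
        φ i k a d (β * β') = φ i j a b β + φ j k b d β') ∧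
    (∀ (i j : c.I) ⦃T : Opens X⦄ (a : T ⟶ c.U i) (b : T ⟶ c.U j)
      (β : B.obj.obj (op T)), p.hom.app (op T) β = c.toOneCocycle.ev i j a b →
        g.hom.app (op T) (φ i j a b β) = q i j a b) ∧
    IsCechClass Q c.U q z ∧
    y = connecting hS 1 z

/-! ## The primary complex -/

namespace AQNormalSeries

variable (H : AQNormalSeries X)

/-- The graph of the map `∂^1 : H^0(X, A j) → H^1(X, A (j + 1))` of the primary complex, formed with
the extension `1 ⟶ A (j + 1) ⟶ H k / H (j + 2) ⟶ H k / H (j + 1) ⟶ 1` for some `k < j + 1`: the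
composition of the map induced by `A j ⟶ H k / H (j + 1)` and of `δ^1`. -/
def IsPrimaryOne (j k : ℕ) (hk : k < j + 1)
    (x : Sheaf.H (H.A j) 0) (y : Sheaf.H (H.A (j + 1)) 1) : Prop :=
  IsDeltaOne
    (H.quotMap hk.le le_rfl : H.quot (j + 1) (j + 2) ⟶ H.quot k (j + 2))
    (H.quotMap le_rfl (Nat.le_succ (j + 1)) : H.quot k (j + 2) ⟶ H.quot k (j + 1))
    (H.aq (j + 1))
    ((H.quotMap (Nat.le_of_lt_succ hk) le_rfl :
        H.quot j (j + 1) ⟶ H.quot k (j + 1)).hom.app (op ⊤)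
      (ofAdd (H.aq j) (globalSections (H.A j) x)))
    y

/-- The graph of the map `∂^2 : H^1(X, A j) → H^2(X, A (j + 1))` of the primary complex, formed with
the same extension as above, which is to be central: the composition of the map
`H^1(X, A j) → Ȟ^1(X, H k / H (j + 1))` induced by `A j ⟶ H k / H (j + 1)` and of `δ^2`. -/
def IsPrimaryTwo (j k : ℕ) (hk : k < j + 1)
    (x : Sheaf.H (H.A j) 1) (y : Sheaf.H (H.A (j + 1)) 2) : Prop :=
  ∃ γ : CechCocycle (H.quot j (j + 1)), γ.HasClass (H.aq j) x ∧
    IsDeltaTwo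
      (H.quotMap hk.le le_rfl : H.quot (j + 1) (j + 2) ⟶ H.quot k (j + 2))
      (H.quotMap le_rfl (Nat.le_succ (j + 1)) : H.quot k (j + 2) ⟶ H.quot k (j + 1))
      (H.aq (j + 1))
      (γ.map (H.quotMap (Nat.le_of_lt_succ hk) le_rfl :
        H.quot j (j + 1) ⟶ H.quot k (j + 1))).class
      y

/-- Actions of a ring `K` on the sheaves `A j` and `H j / H (j + 2)` which make the sequences
`0 ⟶ A (j + 1) ⟶ H j / H (j + 2) ⟶ A j ⟶ 0` sequences of sheaves of `K`-modules. -/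
structure Scalars (hH : H.HasAQDegree 2) (K : Type v) [Ring K] where
  onA : ∀ j, K →+* End (H.A j)
  onE : ∀ j, K →+* End (H.extension hH j).X₂
  f_comm : ∀ j r, onA (j + 1) r ≫ (H.extension hH j).f = (H.extension hH j).f ≫ onE j r
  g_comm : ∀ j r, onE j r ≫ (H.extension hH j).g = (H.extension hH j).g ≫ onA j r

end AQNormalSeries

/-- The `K`-module structure on `H^n(X, F)` induced by an action of `K` on `F`. -/
abbrev cohomologyModule {K : Type v} [Ring K] {F : AbSheaf X} (ρ : K →+* End F) (n : ℕ) :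
    Module K (Sheaf.H F n) where
  smul r x := Sheaf.H.map (ρ r) n x
  one_smul x := by
    change Sheaf.H.map (ρ 1) n x = x
    rw [map_one]
    exact Sheaf.H.map_id_apply x
  mul_smul r s x := by
    change Sheaf.H.map (ρ (r * s)) n x = Sheaf.H.map (ρ r) n (Sheaf.H.map (ρ s) n x)
    rw [map_mul]
    exact Sheaf.H.map_comp_apply (ρ s) (ρ r) x
  smul_zero r := map_zero (Sheaf.H.map (ρ r) n)
  smul_add r := map_add (Sheaf.H.map (ρ r) n)
  add_smul r s x := by
    change Sheaf.H.map (ρ (r + s)) n x = Sheaf.H.map (ρ r) n x + Sheaf.H.map (ρ s) n x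
    rw [map_add]
    exact Sheaf.H.map_add_apply (ρ r) (ρ s) x
  zero_smul x := by
    change Sheaf.H.map (ρ 0) n x = 0
    have h := Sheaf.H.map_add_apply (ρ 0) (ρ 0) x
    rw [← map_add, add_zero] at h
    exact left_eq_add.mp h

/-- The map `d : H^n(X, F) → H^m(X, F')` is `K`-linear for the module structures induced by actions
of `K` on `F` and `F'`. -/
def IsLinearOver {K : Type v} [Ring K] {F F' : AbSheaf X} (ρ : K →+* End F) (ρ' : K →+* End F')
    {n m : ℕ} (d : Sheaf.H F n → Sheaf.H F' m) : Prop :=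
  letI := cohomologyModule ρ n
  letI := cohomologyModule ρ' m
  IsLinearMap K d

end

end AQ

/-! Since $\mathcal H_j/\mathcal H_{j+2}$ is abelian, each $\mathcal A_{j+1}$ is central already in
$\mathcal H_j/\mathcal H_{j+2}$, and $E_j : 0\to\mathcal A_{j+1}\to\mathcal H_j/\mathcal
H_{j+2}\to\mathcal A_j\to0$ is an exact sequence of abelian sheaves. The maps of the primary complex
are taken to be the connecting homomorphisms of $E_j$, so additivity and independence of $k$ are
automatic. The work lies in identifying them with the nonabelian constructions.

The key geometric fact is that $\mathcal H_j/\mathcal H_{j+2}$ is the preimage of $\mathcal A_j$ in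
$\mathcal H_k/\mathcal H_{j+2}$ (`exists_quotMap_eq_and`). Hence every lift of a section or cocycle
coming from $\mathcal A_j$ already lies in the abelian extension $E_j$. In degree $0$ this and the
uniqueness of Čech classes (`IsCechClass.unique`) give the claim.

In degree $1$, the graph of $\delta^2$ allows any representative of the class and any additive,
equivariant map from lifts to an embedding of $\mathcal A_{j+1}$. Centrality permits a change of
representative (`IsLiftMap.exists_of_cohomologous`). Then two such maps are compared inside one
injective embedding: their difference does not depend on the lift, hence is a cocycle of an abelian
sheaf, and this forces the connecting images to agree (`connecting_eq_of_lift`).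

Finally $\partial^2\partial^1=0$ because a section of $\mathcal A_j$ can be lifted locally to
$\mathcal H_j/\mathcal H_{j+3}$: the quotients of these lifts are a cocycle of the abelian sheaf
$\mathcal H_{j+1}/\mathcal H_{j+3}$ which represents a preimage of $\partial^1x$
(`connecting_connecting`). Linearity is naturality of connecting homomorphisms under endomorphisms
of $E_j$. -/

namespace AQ

variable {X : TopCat.{u}}

/-! ## Sections of sheaves -/

section Sections

variable {C : Type*} [Category C] {FC : C → C → Type*} {CC : C → Type*}
  [∀ Y Z, FunLike (FC Y Z) (CC Y) (CC Z)] [ConcreteCategory C FC]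

lemma map_map_apply (F : (Opens X)ᵒᵖ ⥤ C) {T V W : Opens X} (i : V ⟶ T) (j : W ⟶ V)
    (s : ToType (F.obj (op T))) :
    F.map j.op (F.map i.op s) = F.map (j ≫ i).op s := by
  rw [op_comp, F.map_comp, ConcreteCategory.comp_apply]

lemma map_id_op_apply (F : (Opens X)ᵒᵖ ⥤ C) {T : Opens X} (i : T ⟶ T)
    (s : ToType (F.obj (op T))) :
    F.map i.op s = s := by
  rw [Subsingleton.elim i (𝟙 T), op_id, F.map_id, ConcreteCategory.id_apply]

lemma app_map_apply {F G : (Opens X)ᵒᵖ ⥤ C} (f : F ⟶ G) {T V : Opens X} (i : V ⟶ T)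
    (s : ToType (F.obj (op T))) :
    f.app (op V) (F.map i.op s) = G.map i.op (f.app (op T) s) :=
  NatTrans.naturality_apply f i.op s

variable [Limits.HasLimitsOfSize.{u, u} C] [(forget C).ReflectsIsomorphisms]
  [Limits.PreservesLimitsOfSize.{u, u} (forget C)]

/-- Two sections of a sheaf which agree locally are equal. -/
lemma ext_of_local (F : Sheaf (Opens.grothendieckTopology X) C) {T : Opens X}
    {s t : ToType (F.obj.obj (op T))}
    (h : ∀ x ∈ T, ∃ (V : Opens X) (i : V ⟶ T), x ∈ V ∧ F.obj.map i.op s = F.obj.map i.op t) :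
    s = t := by
  choose V i hV h using h
  refine TopCat.Sheaf.eq_of_locally_eq' F (fun x : T => V x x.2) T (fun x => i x x.2) ?_ s t
    fun x => h x x.2
  intro x hx
  exact Opens.mem_iSup.2 ⟨⟨x, hx⟩, hV x hx⟩

/-- Local sections of a sheaf, determined uniquely by a condition stable under restriction, glue. -/
lemma exists_glue (F : Sheaf (Opens.grothendieckTopology X) C) {T : Opens X}
    (P : ∀ ⦃V : Opens X⦄ (_ : V ⟶ T), ToType (F.obj.obj (op V)) → Prop)
    (hres : ∀ ⦃V W : Opens X⦄ (i : V ⟶ T) (j : W ⟶ V) (s : ToType (F.obj.obj (op V))),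
      P i s → P (j ≫ i) (F.obj.map j.op s))
    (huniq : ∀ ⦃V : Opens X⦄ (i : V ⟶ T) (s t : ToType (F.obj.obj (op V))), P i s → P i t → s = t)
    (hex : ∀ x ∈ T, ∃ (V : Opens X) (i : V ⟶ T), x ∈ V ∧ ∃ s, P i s) :
    ∃ s : ToType (F.obj.obj (op T)), ∀ ⦃V : Opens X⦄ (i : V ⟶ T) (t : ToType (F.obj.obj (op V))),
      P i t → F.obj.map i.op s = t := by
  choose V i hV s hs using hex
  obtain ⟨σ, hσ, -⟩ := TopCat.Sheaf.existsUnique_gluing' F (fun x : T => V x x.2) T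
    (fun x => i x x.2) (fun x hx => Opens.mem_iSup.2 ⟨⟨x, hx⟩, hV x hx⟩) (fun x => s x x.2) (by
      intro x y
      refine huniq (homOfLE inf_le_left ≫ i x x.2) _ _ (hres _ _ _ (hs x x.2)) ?_
      rw [Subsingleton.elim (homOfLE inf_le_left ≫ i x x.2) (homOfLE inf_le_right ≫ i y y.2)]
      exact hres _ _ _ (hs y y.2))
  refine ⟨σ, fun W j t ht => ext_of_local F fun x hx => ?_⟩
  refine ⟨W ⊓ V x (j.le hx), homOfLE inf_le_left, ⟨hx, hV x (j.le hx)⟩, ?_⟩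
  refine huniq (homOfLE inf_le_left ≫ j) _ _ ?_ (hres _ _ _ ht)
  rw [map_map_apply]
  have := hres (i x (j.le hx)) (homOfLE inf_le_right : W ⊓ V x (j.le hx) ⟶ _) _ (hs x (j.le hx))
  rw [← hσ ⟨x, j.le hx⟩, map_map_apply] at this
  exact this

/-- If `f` is injective on sections, then a section which locally is in the image of `f` is in the
image of `f`. -/
lemma exists_app_eq_of_local {F G : Sheaf (Opens.grothendieckTopology X) C} (f : F ⟶ G)
    (hf : ∀ V : Opens X, Function.Injective (f.hom.app (op V))) {T : Opens X}
    (t : ToType (G.obj.obj (op T)))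
    (h : ∀ x ∈ T, ∃ (V : Opens X) (i : V ⟶ T), x ∈ V ∧
      ∃ s, f.hom.app (op V) s = G.obj.map i.op t) :
    ∃ s, f.hom.app (op T) s = t := by
  obtain ⟨s, hs⟩ := exists_glue F (T := T)
    (fun V i s => f.hom.app (op V) s = G.obj.map i.op t)
    (fun V W i j s hs => by rw [app_map_apply, hs, map_map_apply])
    (fun V i s s' hs hs' => hf V (hs.trans hs'.symm)) h
  refine ⟨s, ext_of_local G fun x hx => ?_⟩
  obtain ⟨V, i, hV, s', hs'⟩ := h x hx
  exact ⟨V, i, hV, by rw [← app_map_apply, hs i s' hs', hs']⟩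

end Sections

/-- The section-level meaning of local surjectivity. -/
lemma exists_local_lift {C : Type*} [Category C] {FC : C → C → Type*} {CC : C → Type*}
    [∀ Y Z, FunLike (FC Y Z) (CC Y) (CC Z)] [ConcreteCategory C FC]
    {F G : (Opens X)ᵒᵖ ⥤ C} (f : F ⟶ G)
    [Presheaf.IsLocallySurjective (Opens.grothendieckTopology X) f] {T : Opens X}
    (t : ToType (G.obj (op T))) :
    ∀ x ∈ T, ∃ (V : Opens X) (i : V ⟶ T), x ∈ V ∧ ∃ s, f.app (op V) s = G.map i.op t := by
  intro x hx
  obtain ⟨V, i, ⟨s, hs⟩, hV⟩ := Presheaf.imageSieve_mem (Opens.grothendieckTopology X) f t x hx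
  exact ⟨V, i, hV, s, hs⟩

lemma isLocallySurjective_of_exists_local_lift {C : Type*} [Category C] {FC : C → C → Type*}
    {CC : C → Type*} [∀ Y Z, FunLike (FC Y Z) (CC Y) (CC Z)] [ConcreteCategory C FC]
    {F G : (Opens X)ᵒᵖ ⥤ C} (f : F ⟶ G)
    (h : ∀ (T : Opens X) (t : ToType (G.obj (op T))), ∀ x ∈ T,
      ∃ (V : Opens X) (i : V ⟶ T), x ∈ V ∧ ∃ s, f.app (op V) s = G.map i.op t) :
    Presheaf.IsLocallySurjective (Opens.grothendieckTopology X) f where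
  imageSieve_mem {T} t x hx := by
    obtain ⟨V, i, hV, s, hs⟩ := h T t x hx
    exact ⟨V, i, ⟨s, hs⟩, hV⟩

/-! ## Short exact sequences of abelian sheaves -/

section ShortExact

variable {S : ShortComplex (AbSheaf X)} (hS : S.ShortExact)

include hS

lemma ShortExact.app_injective (T : Opens X) : Function.Injective (S.f.hom.app (op T)) := by
  have := hS.mono_f
  have : Mono ((sheafToPresheaf _ _).map S.f) := inferInstance
  have : Mono (((sheafToPresheaf _ _).map S.f).app (op T)) := inferInstance
  exact (AddCommGrpCat.mono_iff_injective _).1 this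

lemma ShortExact.exists_local_lift {T : Opens X} (t : S.X₃.obj.obj (op T)) :
    ∀ x ∈ T, ∃ (V : Opens X) (i : V ⟶ T), x ∈ V ∧
      ∃ s, S.g.hom.app (op V) s = S.X₃.obj.map i.op t := by
  have := (Sheaf.isLocallySurjective_iff_epi' _ S.g).2 hS.epi_g
  have : Presheaf.IsLocallySurjective (Opens.grothendieckTopology X) S.g.hom := this
  exact AQ.exists_local_lift S.g.hom t

/-- Taking sections over `T` is left exact, because both the inclusion into presheaves and
evaluation preserve kernels. -/
lemma ShortExact.exists_app_eq {T : Opens X} (t : S.X₂.obj.obj (op T))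
    (ht : S.g.hom.app (op T) t = 0) : ∃ s, S.f.hom.app (op T) s = t := by
  have := hS.mono_f
  have h := hS.exact.map_of_mono_of_preservesKernel
    (sheafToPresheaf (Opens.grothendieckTopology X) AddCommGrpCat.{u} ⋙
      (evaluation _ _).obj (op T)) hS.mono_f inferInstance
  exact (ShortComplex.ab_exact_iff _).1 h t ht

omit hS in
lemma comp_app_apply (T : Opens X) (s : S.X₁.obj.obj (op T)) :
    S.g.hom.app (op T) (S.f.hom.app (op T) s) = 0 := by
  have := congrArg (fun φ : S.X₁ ⟶ S.X₃ => φ.hom.app (op T) s) S.zero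
  exact this

end ShortExact

lemma mono_of_app_injective {F G : AbSheaf X} (f : F ⟶ G)
    (hf : ∀ T : Opens X, Function.Injective (f.hom.app (op T))) : Mono f := by
  have : ∀ T, Mono (f.hom.app T) := fun T => (AddCommGrpCat.mono_iff_injective _).2 (hf T.unop)
  have : Mono f.hom := NatTrans.mono_of_mono_app _
  exact (sheafToPresheaf _ _).mono_of_mono_map this

/-- A sequence of abelian sheaves is short exact if it is left exact on sections and the second map
is locally surjective. -/
lemma shortExact_of_sections {S : ShortComplex (AbSheaf X)}
    (hf : ∀ T : Opens X, Function.Injective (S.f.hom.app (op T)))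
    (hfg : ∀ (T : Opens X) (t : S.X₂.obj.obj (op T)), S.g.hom.app (op T) t = 0 →
      ∃ s, S.f.hom.app (op T) s = t)
    (hg : ∀ (T : Opens X) (t : S.X₃.obj.obj (op T)), ∀ x ∈ T,
      ∃ (V : Opens X) (i : V ⟶ T), x ∈ V ∧ ∃ s, S.g.hom.app (op V) s = S.X₃.obj.map i.op t) :
    S.ShortExact := by
  have hmono : Mono S.f := mono_of_app_injective _ hf
  have hepi : Epi S.g := (Sheaf.isLocallySurjective_iff_epi' _ S.g).1
    (isLocallySurjective_of_exists_local_lift S.g.hom hg)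
  -- No refinement is needed: preimages under `S.f` are unique on sections, so the chosen ones are
  -- additive and natural and form a morphism of sheaves.
  refine { exact := (S.exact_iff_exact_up_to_refinements).2 fun A φ hφ => ?_ }
  have hφ' (T : Opens X) (a : A.obj.obj (op T)) :
      ∃ s, S.f.hom.app (op T) s = φ.hom.app (op T) a :=
    hfg T _ (congrArg (fun ψ : A ⟶ S.X₃ => ψ.hom.app (op T) a) hφ)
  choose l hl using hφ'
  have hadd (T : Opens X) (a b : A.obj.obj (op T)) : l T (a + b) = l T a + l T b := by
    refine hf T ?_
    rw [map_add, hl, hl, hl, map_add]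
  let ψ : A.obj ⟶ S.X₁.obj :=
    { app := fun T => AddCommGrpCat.ofHom (AddMonoidHom.mk' (l T.unop) (hadd T.unop))
      naturality := ?_ }
  · refine ⟨A, 𝟙 A, inferInstance, ⟨ψ⟩, ?_⟩
    ext T a
    exact (hl T.unop a).symm
  · intro T V i
    ext a
    refine hf V.unop ?_
    refine (hl V.unop (A.obj.map i a)).trans ?_
    refine (NatTrans.naturality_apply φ.hom i a).trans ?_
    refine (congrArg _ (hl T.unop a).symm).trans ?_
    exact (NatTrans.naturality_apply S.f.hom i (l T.unop a)).symm

/-! ## Connecting homomorphisms -/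

/-- Connecting homomorphisms are Yoneda products with the extension class, so this reduces to
naturality of that class and associativity. -/
lemma connecting_naturality {S S' : ShortComplex (AbSheaf X)} (hS : S.ShortExact)
    (hS' : S'.ShortExact) (φ : S ⟶ S') (n : ℕ) (x : Sheaf.H S.X₃ n) :
    Sheaf.H.map φ.τ₁ (n + 1) (connecting hS n x) =
      connecting hS' n (Sheaf.H.map φ.τ₃ n x) := by
  change (x.comp hS.extClass rfl).comp (Abelian.Ext.mk₀ φ.τ₁) (add_zero _) =
    (x.comp (Abelian.Ext.mk₀ φ.τ₃) (add_zero n)).comp hS'.extClass rfl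
  rw [Abelian.Ext.comp_assoc x _ _ rfl (add_zero 1) (by lia),
    ShortComplex.ShortExact.extClass_naturality hS hS' φ,
    Abelian.Ext.comp_assoc x _ _ (add_zero n) (zero_add 1) (by lia)]

lemma connecting_map_g {S : ShortComplex (AbSheaf X)} (hS : S.ShortExact) (n : ℕ)
    (x : Sheaf.H S.X₂ n) : connecting hS n (Sheaf.H.map S.g n x) = 0 := by
  change (x.comp (Abelian.Ext.mk₀ S.g) (add_zero n)).comp hS.extClass rfl = 0
  rw [Abelian.Ext.comp_assoc x _ _ (add_zero n) (zero_add 1) (by lia),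
    ShortComplex.ShortExact.comp_extClass, Abelian.Ext.comp_zero]

/-- Dimension shifting: the positive cohomology of an injective sheaf vanishes. -/
lemma exists_connecting_eq {S : ShortComplex (AbSheaf X)} (hS : S.ShortExact)
    [Injective S.X₂] (n : ℕ) (x : Sheaf.H S.X₁ (n + 1)) :
    ∃ z, connecting hS n z = x :=
  Abelian.Ext.covariant_sequence_exact₁ _ hS x (Subsingleton.elim (α := Sheaf.H S.X₂ (n + 1)) _ _)
    rfl

/-- The quotient of a sheaf by the image of a morphism. -/
noncomputable abbrev cokernelSequence {F J : AbSheaf X} (f : F ⟶ J) : ShortComplex (AbSheaf X) :=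
  ShortComplex.mk f (Limits.cokernel.π f) (Limits.cokernel.condition f)

lemma cokernelSequence_shortExact {F J : AbSheaf X} (f : F ⟶ J) [Mono f] :
    (cokernelSequence f).ShortExact where
  exact := ShortComplex.exact_cokernel f

/-- An embedding of an abelian sheaf in an injective sheaf, with its quotient. -/
noncomputable abbrev injectiveSequence (F : AbSheaf X) : ShortComplex (AbSheaf X) :=
  cokernelSequence (Injective.ι F)

lemma injectiveSequence_shortExact (F : AbSheaf X) : (injectiveSequence F).ShortExact :=
  cokernelSequence_shortExact _

/-- Extend `m ≫ Injective.ι F` along the monomorphism `S.f` and pass to quotients. This moves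
classes computed with unrelated sequences into a common one, where they can be subtracted. -/
lemma exists_hom_injectiveSequence {S : ShortComplex (AbSheaf X)} (hS : S.ShortExact)
    {F : AbSheaf X} (m : S.X₁ ⟶ F) : ∃ φ : S ⟶ injectiveSequence F, φ.τ₁ = m := by
  have := hS.mono_f
  have := hS.epi_g
  have h : S.f ≫ Injective.factorThru (m ≫ Injective.ι F) S.f = m ≫ Injective.ι F :=
    Injective.comp_factorThru _ _
  refine ⟨⟨m, Injective.factorThru (m ≫ Injective.ι F) S.f, hS.exact.desc
    (Injective.factorThru (m ≫ Injective.ι F) S.f ≫ Limits.cokernel.π (Injective.ι F)) ?_,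
    h.symm, ?_⟩, rfl⟩
  · rw [← Category.assoc, h, Category.assoc, Limits.cokernel.condition, Limits.comp_zero]
  · exact (hS.exact.g_desc _ _).symm

/-! ## Čech classes -/

/-- The family `γ` is the coboundary in `S.X₂` of local lifts of a global section of `S.X₃`, and
`x` is the image of this section under the connecting homomorphism. -/
def IsCechClassIn {S : ShortComplex (AbSheaf X)} (hS : S.ShortExact) {I : Type u} (U : I → Opens X)
    (γ : ∀ (i j : I) ⦃T : Opens X⦄ (_ : T ⟶ U i) (_ : T ⟶ U j), S.X₁.obj.obj (op T))
    (x : Sheaf.H S.X₁ 1) : Prop :=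
  ∃ (q : S.X₃.obj.obj (op ⊤)) (s : ∀ i, S.X₂.obj.obj (op (U i))),
    (∀ i, S.g.hom.app (op (U i)) (s i) = S.X₃.obj.map (homOfLE le_top).op q) ∧
    (∀ (i j : I) ⦃T : Opens X⦄ (a : T ⟶ U i) (b : T ⟶ U j),
      S.f.hom.app (op T) (γ i j a b) = S.X₂.obj.map a.op (s i) - S.X₂.obj.map b.op (s j)) ∧
    x = connecting hS 0 ((globalSections S.X₃).symm q)

lemma IsCechClassIn.isCechClass {S : ShortComplex (AbSheaf X)} {hS : S.ShortExact} {I : Type u}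
    {U : I → Opens X}
    {γ : ∀ (i j : I) ⦃T : Opens X⦄ (_ : T ⟶ U i) (_ : T ⟶ U j), S.X₁.obj.obj (op T)}
    {x : Sheaf.H S.X₁ 1} (h : IsCechClassIn hS U γ x) : IsCechClass S.X₁ U γ x :=
  ⟨S.X₂, S.X₃, S.f, S.g, S.zero, hS, h⟩

lemma IsCechClassIn.map {S S' : ShortComplex (AbSheaf X)} {hS : S.ShortExact}
    (hS' : S'.ShortExact) (φ : S ⟶ S') {I : Type u} {U : I → Opens X}
    {γ : ∀ (i j : I) ⦃T : Opens X⦄ (_ : T ⟶ U i) (_ : T ⟶ U j), S.X₁.obj.obj (op T)}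
    {x : Sheaf.H S.X₁ 1} (h : IsCechClassIn hS U γ x) :
    IsCechClassIn hS' U (fun i j T a b => φ.τ₁.hom.app (op T) (γ i j a b))
      (Sheaf.H.map φ.τ₁ 1 x) := by
  obtain ⟨q, s, hs, hγ, rfl⟩ := h
  have h₁₂ (T : Opens X) (t : S.X₁.obj.obj (op T)) :
      S'.f.hom.app (op T) (φ.τ₁.hom.app (op T) t) = φ.τ₂.hom.app (op T) (S.f.hom.app (op T) t) :=
    congrArg (fun ψ : S.X₁ ⟶ S'.X₂ => ψ.hom.app (op T) t) φ.comm₁₂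
  have h₂₃ (T : Opens X) (t : S.X₂.obj.obj (op T)) :
      S'.g.hom.app (op T) (φ.τ₂.hom.app (op T) t) = φ.τ₃.hom.app (op T) (S.g.hom.app (op T) t) :=
    congrArg (fun ψ : S.X₂ ⟶ S'.X₃ => ψ.hom.app (op T) t) φ.comm₂₃
  refine ⟨φ.τ₃.hom.app (op ⊤) q, fun i => φ.τ₂.hom.app (op (U i)) (s i), fun i => ?_,
    fun i j T a b => ?_, ?_⟩
  · rw [h₂₃, hs, app_map_apply]
  · rw [h₁₂, hγ, map_sub, app_map_apply, app_map_apply]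
  · rw [connecting_naturality hS hS' φ]
    exact congrArg _ (Sheaf.H.equiv₀_symm_naturality Limits.isTerminalTop φ.τ₃ q)

lemma IsCechClassIn.sub {S : ShortComplex (AbSheaf X)} {hS : S.ShortExact} {I : Type u}
    {U : I → Opens X}
    {γ γ' : ∀ (i j : I) ⦃T : Opens X⦄ (_ : T ⟶ U i) (_ : T ⟶ U j), S.X₁.obj.obj (op T)}
    {x x' : Sheaf.H S.X₁ 1} (h : IsCechClassIn hS U γ x) (h' : IsCechClassIn hS U γ' x') :
    IsCechClassIn hS U (fun i j _ a b => γ i j a b - γ' i j a b) (x - x') := by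
  obtain ⟨q, s, hs, hγ, rfl⟩ := h
  obtain ⟨q', s', hs', hγ', rfl⟩ := h'
  refine ⟨q - q', fun i => s i - s' i, fun i => ?_, fun i j T a b => ?_, ?_⟩
  · rw [map_sub, map_sub, hs, hs']
  · rw [map_sub, map_sub, map_sub, hγ, hγ']
    abel
  · rw [map_sub, map_sub]

/-- When the cocycle vanishes, the local lifts agree on overlaps and glue to a global lift of `q`;
the connecting homomorphism kills sections that lift. -/
lemma IsCechClassIn.eq_zero {S : ShortComplex (AbSheaf X)} {hS : S.ShortExact} {I : Type u}
    {U : I → Opens X} (hU : ∀ x : X, ∃ i, x ∈ U i)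
    {γ : ∀ (i j : I) ⦃T : Opens X⦄ (_ : T ⟶ U i) (_ : T ⟶ U j), S.X₁.obj.obj (op T)}
    {x : Sheaf.H S.X₁ 1} (h : IsCechClassIn hS U γ x)
    (h0 : ∀ i j ⦃T⦄ (a : T ⟶ U i) (b : T ⟶ U j), γ i j a b = 0) : x = 0 := by
  obtain ⟨q, s, hs, hγ, rfl⟩ := h
  have hγ' (i j : I) ⦃T : Opens X⦄ (a : T ⟶ U i) (b : T ⟶ U j) :
      S.X₂.obj.map a.op (s i) = S.X₂.obj.map b.op (s j) := by
    have := hγ i j a b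
    rw [h0, map_zero] at this
    exact sub_eq_zero.1 this.symm
  obtain ⟨t, ht⟩ := exists_glue S.X₂ (T := ⊤)
    (fun V _ t => ∃ (i : I) (a : V ⟶ U i), t = S.X₂.obj.map a.op (s i))
    (by
      rintro V W - b _ ⟨i, a, rfl⟩
      exact ⟨i, b ≫ a, map_map_apply _ _ _ _⟩)
    (by
      rintro V - _ _ ⟨i, a, rfl⟩ ⟨j, b, rfl⟩
      exact hγ' i j a b)
    (fun x _ => by
      obtain ⟨i, hi⟩ := hU x
      exact ⟨U i, homOfLE le_top, hi, _, i, 𝟙 _, rfl⟩)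
  have hq : S.g.hom.app (op ⊤) t = q := by
    refine ext_of_local S.X₃ fun x _ => ?_
    obtain ⟨i, hi⟩ := hU x
    refine ⟨U i, homOfLE le_top, hi, ?_⟩
    rw [← app_map_apply, ht (homOfLE le_top) _ ⟨i, 𝟙 _, rfl⟩, map_id_op_apply, hs]
  rw [← hq]
  have := Sheaf.H.equiv₀_symm_naturality Limits.isTerminalTop S.g t
  exact (congrArg (connecting hS 0) this.symm).trans (connecting_map_g hS 0 _)

section IsCechClass

variable {F F' : AbSheaf X} {I : Type u} {U : I → Opens X}
  {γ γ' : ∀ (i j : I) ⦃T : Opens X⦄ (_ : T ⟶ U i) (_ : T ⟶ U j), F.obj.obj (op T)}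
  {x x' : Sheaf.H F 1}

/-- Čech classes can be computed with an embedding in an injective sheaf. -/
lemma IsCechClass.map_injectiveSequence (h : IsCechClass F U γ x) (m : F ⟶ F') :
    IsCechClassIn (injectiveSequence_shortExact F') U (fun i j T a b => m.hom.app (op T) (γ i j a b))
      (Sheaf.H.map m 1 x) := by
  obtain ⟨J, Q, f, g, w, hS, h⟩ := h
  obtain ⟨φ, hφ⟩ := exists_hom_injectiveSequence hS m
  have := IsCechClassIn.map (injectiveSequence_shortExact F') φ (hS := hS) h
  rw [hφ] at this
  exact this

lemma IsCechClass.map (h : IsCechClass F U γ x) (m : F ⟶ F') :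
    IsCechClass F' U (fun i j T a b => m.hom.app (op T) (γ i j a b)) (Sheaf.H.map m 1 x) :=
  (h.map_injectiveSequence m).isCechClass

lemma IsCechClass.injectiveSequence (h : IsCechClass F U γ x) :
    IsCechClassIn (injectiveSequence_shortExact F) U γ x := by
  have := h.map_injectiveSequence (𝟙 F)
  rw [Sheaf.H.map_id_apply] at this
  exact this

lemma IsCechClass.sub (h : IsCechClass F U γ x) (h' : IsCechClass F U γ' x') :
    IsCechClass F U (fun i j _ a b => γ i j a b - γ' i j a b) (x - x') :=
  (h.injectiveSequence.sub h'.injectiveSequence).isCechClass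

/-- The cohomology class of a Čech cocycle is unique. -/
lemma IsCechClass.unique (hU : ∀ x : X, ∃ i, x ∈ U i) (h : IsCechClass F U γ x)
    (h' : IsCechClass F U γ' x')
    (hγ : ∀ i j ⦃T⦄ (a : T ⟶ U i) (b : T ⟶ U j), γ i j a b = γ' i j a b) : x = x' :=
  sub_eq_zero.1 <| (h.injectiveSequence.sub h'.injectiveSequence).eq_zero hU
    fun i j _ a b => sub_eq_zero.2 (hγ i j a b)

lemma IsCechClass.refine {K : Type u} {W : K → Opens X} (h : IsCechClass F U γ x) (r : K → I)
    (r' : ∀ k, W k ⟶ U (r k)) :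
    IsCechClass F W (fun k l _ a b => γ (r k) (r l) (a ≫ r' k) (b ≫ r' l)) x := by
  obtain ⟨J, Q, f, g, w, hS, q, s, hs, hγ, hx⟩ := h
  refine ⟨J, Q, f, g, w, hS, q, fun k => J.obj.map (r' k).op (s (r k)), fun k => ?_,
    fun k l T a b => ?_, hx⟩
  · rw [app_map_apply, hs, map_map_apply]
    rfl
  · rw [hγ, map_map_apply, map_map_apply]

/-- Compatibility with restriction is not part of `IsCechClass`; it follows because `γ` becomes a
difference of restrictions under the injective map `f`. -/
lemma IsCechClass.map_precomp (h : IsCechClass F U γ x) (i j : I) ⦃T T' : Opens X⦄ (t : T' ⟶ T)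
    (a : T ⟶ U i) (b : T ⟶ U j) : F.obj.map t.op (γ i j a b) = γ i j (t ≫ a) (t ≫ b) := by
  obtain ⟨J, Q, f, g, w, hS, q, s, hs, hγ, hx⟩ := h
  refine ShortExact.app_injective hS T' ?_
  refine (app_map_apply f.hom t _).trans ?_
  refine Eq.trans ?_ (hγ i j (t ≫ a) (t ≫ b)).symm
  rw [hγ, map_sub, map_map_apply, map_map_apply]

end IsCechClass

/-! ## The Čech sheaf of a covering -/

section CechSheaf

variable (P : AbSheaf X) {I : Type u} (U : I → Opens X)

/-- The presheaf `T ↦ ∏ i, P (T ∩ U i)`. -/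
def cechPresheaf : (Opens X)ᵒᵖ ⥤ AddCommGrpCat.{u} where
  obj T := AddCommGrpCat.of (∀ i, P.obj.obj (op (T.unop ⊓ U i)))
  map {T T'} t := AddCommGrpCat.ofHom (AddMonoidHom.mk'
    (fun s i => P.obj.map (homOfLE (inf_le_inf_right (U i) t.unop.le)).op (s i))
    fun s s' => by
      funext i
      exact map_add _ _ _)
  map_id T := by
    ext s i
    exact map_id_op_apply P.obj _ (s i)
  map_comp {T T' T''} t t' := by
    ext s i
    exact (map_map_apply P.obj _ _ (s i)).symm

/-- The sheaf `T ↦ ∏ i, P (T ∩ U i)`. -/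
def cechSheaf : AbSheaf X where
  obj := cechPresheaf P U
  property := by
    refine (TopCat.Presheaf.isSheaf_iff_isSheafUniqueGluing (cechPresheaf P U)).2 ?_
    intro ι V sf hsf
    have key (i : I) := TopCat.Sheaf.existsUnique_gluing' P (fun k => V k ⊓ U i) (iSup V ⊓ U i)
      (fun k => homOfLE (inf_le_inf_right _ (le_iSup V k)))
      (by rw [iSup_inf_eq])
      (fun k => sf k i) (by
        intro k l
        have := congrArg (fun s => P.obj.map (homOfLE (show V k ⊓ U i ⊓ (V l ⊓ U i) ≤
          V k ⊓ V l ⊓ U i from le_inf (inf_le_inf inf_le_left inf_le_left)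
            (inf_le_left.trans inf_le_right))).op (s i)) (hsf k l)
        exact ((map_map_apply P.obj _ _ (sf k i)).symm.trans this).trans
          (map_map_apply P.obj _ _ (sf l i)))
    choose s hs hs' using key
    refine ⟨s, fun k => funext fun i => hs i k, fun t ht => funext fun i => hs' i (t i) fun k =>
      congrFun (ht k) i⟩

/-- The restriction maps `P T → ∏ i, P (T ∩ U i)`. -/
def toCechSheaf : P ⟶ cechSheaf P U where
  hom :=
    { app T := AddCommGrpCat.ofHom (AddMonoidHom.mk'
        (fun s i => P.obj.map (homOfLE inf_le_left : T.unop ⊓ U i ⟶ T.unop).op s)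
        fun s s' => by
          funext i
          exact map_add _ _ _)
      naturality T T' t := by
        ext s
        funext i
        refine (map_map_apply P.obj t.unop (homOfLE inf_le_left) s).trans ?_
        exact (map_map_apply P.obj (homOfLE inf_le_left)
          (homOfLE (inf_le_inf_right (U i) t.unop.le)) s).symm }

variable {U}

lemma toCechSheaf_injective (hU : ∀ x : X, ∃ i, x ∈ U i) (T : Opens X) :
    Function.Injective ((toCechSheaf P U).hom.app (op T)) := by
  intro s t h
  refine ext_of_local P fun x hx => ?_
  obtain ⟨i, hi⟩ := hU x
  exact ⟨T ⊓ U i, homOfLE inf_le_left, ⟨hx, hi⟩, congrFun h i⟩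

/-- Every Čech cocycle has a cohomology class. -/
lemma exists_isCechClass (hU : ∀ x : X, ∃ i, x ∈ U i)
    (ψ : ∀ (i j : I) ⦃T : Opens X⦄ (_ : T ⟶ U i) (_ : T ⟶ U j), P.obj.obj (op T))
    (hres : ∀ (i j : I) ⦃T T' : Opens X⦄ (t : T' ⟶ T) (a : T ⟶ U i) (b : T ⟶ U j),
      P.obj.map t.op (ψ i j a b) = ψ i j (t ≫ a) (t ≫ b))
    (hψ : ∀ (i j k : I) ⦃T : Opens X⦄ (a : T ⟶ U i) (b : T ⟶ U j) (c : T ⟶ U k),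
      ψ i j a b + ψ j k b c = ψ i k a c) :
    ∃ w, IsCechClass P U ψ w := by
  have := mono_of_app_injective _ (toCechSheaf_injective P hU)
  have hS := cokernelSequence_shortExact (toCechSheaf P U)
  -- The usual contraction of the Čech complex: the cochain with `l`-component `ψ i l` has
  -- coboundary `ψ` by the cocycle identity.
  let s (i : I) : (cechSheaf P U).obj.obj (op (U i)) :=
    fun l => ψ i l (homOfLE inf_le_left) (homOfLE inf_le_right)
  have hs (i j : I) ⦃T : Opens X⦄ (a : T ⟶ U i) (b : T ⟶ U j) :
      (toCechSheaf P U).hom.app (op T) (ψ i j a b) =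
        (cechSheaf P U).obj.map a.op (s i) - (cechSheaf P U).obj.map b.op (s j) := by
    refine eq_sub_of_add_eq ?_
    funext l
    have h₁ := hres i j (homOfLE inf_le_left : T ⊓ U l ⟶ T) a b
    have h₂ := hres j l (homOfLE (inf_le_inf_right (U l) b.le)) (homOfLE inf_le_left)
      (homOfLE inf_le_right)
    have h₃ := hres i l (homOfLE (inf_le_inf_right (U l) a.le)) (homOfLE inf_le_left)
      (homOfLE inf_le_right)
    exact (congrArg₂ (· + ·) h₁ h₂).trans ((hψ i j l _ _ _).trans h₃.symm)
  -- The sections `s i` differ on overlaps by sections of `P`, so their images in the quotient glue.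
  obtain ⟨q, hq⟩ := exists_glue (cokernelSequence (toCechSheaf P U)).X₃ (T := ⊤)
    (fun V _ t => ∃ (i : I) (a : V ⟶ U i), t = (cokernelSequence (toCechSheaf P U)).g.hom.app _
      ((cechSheaf P U).obj.map a.op (s i)))
    (by
      rintro V W - b _ ⟨i, a, rfl⟩
      exact ⟨i, b ≫ a, by rw [← app_map_apply, map_map_apply]⟩)
    (by
      rintro V - _ _ ⟨i, a, rfl⟩ ⟨j, b, rfl⟩
      rw [← sub_eq_zero, ← map_sub, ← hs]
      exact comp_app_apply _ _)
    (fun x _ => by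
      obtain ⟨i, hi⟩ := hU x
      exact ⟨U i, homOfLE le_top, hi, _, i, 𝟙 _, rfl⟩)
  refine ⟨_, IsCechClassIn.isCechClass (hS := hS) ⟨q, s, fun i => ?_, hs, rfl⟩⟩
  rw [hq (homOfLE le_top) _ ⟨i, 𝟙 _, rfl⟩, map_id_op_apply]

end CechSheaf

/-! ## Cocycles of abelian sheaves of groups -/

section OneCocycle

variable {A : GroupSheaf X} (hA : IsAbelian A) {J Q : AbSheaf X} {f : additive A hA ⟶ J} {g : J ⟶ Q}
  {w : f ≫ g = 0} (hS : (ShortComplex.mk f g w).ShortExact)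

include hS

/-- The coboundary of local lifts of a section is a cocycle. -/
lemma exists_oneCocycle {I : Type u} (U : I → Opens X) (s : ∀ i, J.obj.obj (op (U i)))
    (hs : ∀ (i j : I) ⦃T : Opens X⦄ (a : T ⟶ U i) (b : T ⟶ U j),
      g.hom.app (op T) (J.obj.map a.op (s i)) = g.hom.app (op T) (J.obj.map b.op (s j))) :
    ∃ γ : PresheafOfGroups.OneCocycle A.obj U, ∀ (i j : I) ⦃T : Opens X⦄ (a : T ⟶ U i)
      (b : T ⟶ U j), f.hom.app (op T) (toAdd hA (γ.ev i j a b)) =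
        J.obj.map a.op (s i) - J.obj.map b.op (s j) := by
  have key (i j : I) ⦃T : Opens X⦄ (a : T ⟶ U i) (b : T ⟶ U j) :
      ∃ γ : A.obj.obj (op T), f.hom.app (op T) (toAdd hA γ) =
        J.obj.map a.op (s i) - J.obj.map b.op (s j) :=
    ShortExact.exists_app_eq hS _ ((map_sub (g.hom.app (op T)).hom _ _).trans
      (sub_eq_zero.2 (hs i j a b)))
  choose γ hγ using key
  have hinj (T : Opens X) (x y : A.obj.obj (op T))
      (h : f.hom.app (op T) (toAdd hA x) = f.hom.app (op T) (toAdd hA y)) : x = y :=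
    ShortExact.app_injective hS T h
  refine ⟨⟨⟨γ, fun i j T T' t a b => hinj _ _ _ ?_⟩, fun i j k T a b c => hinj _ _ _ ?_⟩, hγ⟩
  · refine (app_map_apply f.hom t (toAdd hA (γ i j a b))).trans ?_
    refine (congrArg _ (hγ i j a b)).trans ?_
    rw [hγ, map_sub, map_map_apply, map_map_apply]
  · refine (map_add (f.hom.app (op T)).hom (toAdd hA (γ i j a b)) (toAdd hA (γ j k b c))).trans ?_
    refine (congrArg₂ (· + ·) (hγ i j a b) (hγ j k b c)).trans ?_
    rw [hγ]
    abel

/-- Local lifts of a global section give a cocycle whose class is the image of this section under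
the connecting homomorphism. -/
lemma exists_hasClass_connecting (q : Q.obj.obj (op ⊤)) :
    ∃ (γ : CechCocycle A) (s : ∀ i, J.obj.obj (op (γ.U i))),
      (∀ i, g.hom.app (op (γ.U i)) (s i) = Q.obj.map (homOfLE le_top).op q) ∧
      (∀ (i j : γ.I) ⦃T : Opens X⦄ (a : T ⟶ γ.U i) (b : T ⟶ γ.U j),
        f.hom.app (op T) (toAdd hA (γ.toOneCocycle.ev i j a b)) =
          J.obj.map a.op (s i) - J.obj.map b.op (s j)) ∧
      γ.HasClass hA (connecting hS 0 ((globalSections Q).symm q)) := by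
  have h := fun x : X => ShortExact.exists_local_lift hS (T := ⊤) q x trivial
  choose U i hU s hs using h
  obtain ⟨γ, hγ⟩ := exists_oneCocycle hA hS U s (fun x y T a b => by
    refine (app_map_apply g.hom a _).trans ((congrArg _ (hs x)).trans ?_)
    refine Eq.trans ?_ ((app_map_apply g.hom b _).trans (congrArg _ (hs y))).symm
    exact (map_map_apply Q.obj (i x) a q).trans (map_map_apply Q.obj (i y) b q).symm)
  exact ⟨⟨X, U, fun x => ⟨x, hU x⟩, γ⟩, s, hs, hγ, J, Q, f, g, w, hS, q, s, hs, hγ, rfl⟩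

omit hS in
-- Embedding in an injective sheaf writes `x` as the connecting image of a global section, whose
-- local lifts give the cocycle.
lemma exists_hasClass (x : Sheaf.H (additive A hA) 1) : ∃ γ : CechCocycle A, γ.HasClass hA x := by
  obtain ⟨z, rfl⟩ := exists_connecting_eq (injectiveSequence_shortExact (additive A hA)) 0 x
  obtain ⟨γ, s, -, -, h⟩ := exists_hasClass_connecting hA
    (injectiveSequence_shortExact (additive A hA)) (globalSections _ z)
  rw [AddEquiv.symm_apply_apply] at h
  exact ⟨γ, h⟩

end OneCocycle

/-! ## Sections of the quotient sheaves of a normal series -/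

namespace NormalSeries

variable (H : NormalSeries X)

lemma quotMap_quotMap_apply {k m k' m' k'' m'' : ℕ} (hk : k' ≤ k) (hm : m' ≤ m) (hk' : k'' ≤ k')
    (hm' : m'' ≤ m') {T : (Opens X)ᵒᵖ} (s : (H.quot k m).obj.obj T) :
    (H.quotMap hk' hm').hom.app T ((H.quotMap hk hm).hom.app T s) =
      (H.quotMap (hk'.trans hk) (hm'.trans hm)).hom.app T s :=
  congrArg (fun φ : H.quot k m ⟶ H.quot k'' m'' => φ.hom.app T s) (H.quotMap_comp hk hm hk' hm')

/-- The map is injective already on presheaf quotients, since the denominators agree, and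
sheafification preserves local injectivity. -/
lemma quotMap_injective {k k' : ℕ} (hk : k' ≤ k) (m : ℕ) (T : Opens X) :
    Function.Injective ((H.quotMap hk (le_refl m)).hom.app (op T)) := by
  have h : Presheaf.IsLocallyInjective (Opens.grothendieckTopology X)
      (H.quotPresheafMap hk (le_refl m)) := by
    refine Presheaf.isLocallyInjective_of_injective _ _ fun U s t h => ?_
    obtain ⟨s, rfl⟩ := QuotientGroup.mk_surjective (s := (H.H m U).subgroupOf (H.H k U)) s
    obtain ⟨t, rfl⟩ := QuotientGroup.mk_surjective (s := (H.H m U).subgroupOf (H.H k U)) t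
    exact QuotientGroup.eq.2 (show (s⁻¹ * t).1 ∈ H.H m U from
      (QuotientGroup.eq (s := (H.H m U).subgroupOf (H.H k' U))).1 h)
  exact (Sheaf.isLocallyInjective_iff_injective _).1
    ((Presheaf.isLocallyInjective_presheafToSheaf_map_iff _ _).2 h) (op T)

lemma quotMap_isLocallySurjective (k : ℕ) {m m' : ℕ} (hm : m' ≤ m) :
    Presheaf.IsLocallySurjective (Opens.grothendieckTopology X)
      (H.quotMap (le_refl k) hm).hom := by
  have h : Presheaf.IsLocallySurjective (Opens.grothendieckTopology X)
      (H.quotPresheafMap (le_refl k) hm) := by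
    refine Presheaf.isLocallySurjective_of_surjective _ _ fun U s => ?_
    obtain ⟨s, rfl⟩ := QuotientGroup.mk_surjective (s := (H.H m' U).subgroupOf (H.H k U)) s
    exact ⟨QuotientGroup.mk s, rfl⟩
  exact (Presheaf.isLocallySurjective_presheafToSheaf_map_iff _ _).2 h

lemma quotMap_exists_local_lift (k : ℕ) {m m' : ℕ} (hm : m' ≤ m) {T : Opens X}
    (t : (H.quot k m').obj.obj (op T)) :
    ∀ x ∈ T, ∃ (V : Opens X) (i : V ⟶ T), x ∈ V ∧ ∃ s : (H.quot k m).obj.obj (op V),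
      (H.quotMap (le_refl k) hm).hom.app (op V) s = (H.quot k m').obj.map i.op t := by
  have := H.quotMap_isLocallySurjective k hm
  exact exists_local_lift (H.quotMap (le_refl k) hm).hom t

/-- The map from the presheaf quotient to its sheafification. -/
noncomputable def toQuot (k m : ℕ) : H.quotPresheaf k m ⟶ (H.quot k m).obj :=
  toSheafify (Opens.grothendieckTopology X) (H.quotPresheaf k m)

lemma quotMap_toQuot {k m k' m' : ℕ} (hk : k' ≤ k) (hm : m' ≤ m) {U : (Opens X)ᵒᵖ}
    (s : (H.quotPresheaf k m).obj U) :
    (H.quotMap hk hm).hom.app U ((H.toQuot k m).app U s) =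
      (H.toQuot k' m').app U ((H.quotPresheafMap hk hm).app U s) :=
  (congrArg (fun φ : H.quotPresheaf k m ⟶ (H.quot k' m').obj => φ.app U s)
    (toSheafify_naturality (Opens.grothendieckTopology X) (H.quotPresheafMap hk hm))).symm

/-- Exactness of `H l / H m → H k / H m → H k / H l` on sections. -/
lemma exists_quotMap_eq {k l m : ℕ} (hkl : k ≤ l) (hlm : l ≤ m) {T : Opens X}
    (b : (H.quot k m).obj.obj (op T))
    (hb : (H.quotMap (le_refl k) hlm).hom.app (op T) b = 1) :
    ∃ a : (H.quot l m).obj.obj (op T), (H.quotMap hkl (le_refl m)).hom.app (op T) a = b := by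
  refine exists_app_eq_of_local _ (H.quotMap_injective hkl m) b fun x hx => ?_
  have hsurj : Presheaf.IsLocallySurjective (Opens.grothendieckTopology X) (H.toQuot k m) :=
    inferInstanceAs (Presheaf.IsLocallySurjective _ (toSheafify _ _))
  have hinj : Presheaf.IsLocallyInjective (Opens.grothendieckTopology X) (H.toQuot k l) :=
    inferInstanceAs (Presheaf.IsLocallyInjective _ (toSheafify _ _))
  obtain ⟨V, i, hV, s, hs⟩ := exists_local_lift (H.toQuot k m) b x hx
  obtain ⟨s, rfl⟩ := QuotientGroup.mk_surjective
    (s := (H.H m (op V)).subgroupOf (H.H k (op V))) s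
  have h1 : (H.toQuot k l).app (op V) (QuotientGroup.mk s) = (H.toQuot k l).app (op V) 1 := by
    rw [map_one]
    refine (H.quotMap_toQuot (le_refl k) hlm (U := op V) (QuotientGroup.mk s)).symm.trans ?_
    rw [hs, app_map_apply, hb, map_one]
  -- A presheaf section that becomes trivial in the sheafification is trivial after shrinking; so
  -- the representative `s` of `b` lies in `H l` over `W`.
  obtain ⟨W, j, hj, hW⟩ := Presheaf.equalizerSieve_mem (Opens.grothendieckTopology X)
    (H.toQuot k l) _ _ h1 x hV
  have hsl : H.G.obj.map j.op s.1 ∈ H.H l (op W) := by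
    have hj' : (H.quotPresheaf k l).map j.op (QuotientGroup.mk s) = 1 := hj.trans (map_one _)
    exact (QuotientGroup.eq_one_iff (N := (H.H l (op W)).subgroupOf (H.H k (op W)))
      (H.restrict k j.op s)).1 hj'
  refine ⟨W, j ≫ i, hW, (H.toQuot l m).app (op W)
    (QuotientGroup.mk ⟨H.G.obj.map j.op s.1, hsl⟩), ?_⟩
  refine (H.quotMap_toQuot hkl (le_refl m) (U := op W) _).trans ?_
  exact (app_map_apply (H.toQuot k m) j (QuotientGroup.mk s)).trans
    ((congrArg _ hs).trans (map_map_apply _ i j b))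

/-- The square formed by `H l / H m → H k / H m` and `H l / H m' → H k / H m'` is cartesian. -/
lemma exists_quotMap_eq_and {k l m m' : ℕ} (hkl : k ≤ l) (hlm : l ≤ m') (hm : m' ≤ m)
    {T : Opens X} (b : (H.quot k m).obj.obj (op T)) (a : (H.quot l m').obj.obj (op T))
    (hb : (H.quotMap (le_refl k) hm).hom.app (op T) b =
      (H.quotMap hkl (le_refl m')).hom.app (op T) a) :
    ∃ e : (H.quot l m).obj.obj (op T), (H.quotMap hkl (le_refl m)).hom.app (op T) e = b ∧
      (H.quotMap (le_refl l) hm).hom.app (op T) e = a := by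
  have key : ∃ e : (H.quot l m).obj.obj (op T),
      (H.quotMap hkl (le_refl m)).hom.app (op T) e = b := by
    refine exists_app_eq_of_local _ (H.quotMap_injective hkl m) b fun x hx => ?_
    obtain ⟨V, i, hV, e, he⟩ := H.quotMap_exists_local_lift l hm a x hx
    -- A local lift `e` of `a` differs from `b` by a section of `H m' / H m`, which also lies in `H
    -- l / H m` and corrects `e`.
    obtain ⟨d, hd⟩ := H.exists_quotMap_eq (hkl.trans hlm) hm
      (((H.quotMap hkl (le_refl m)).hom.app (op V) e)⁻¹ * (H.quot k m).obj.map i.op b) (by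
        rw [map_mul, map_inv, app_map_apply, hb, ← app_map_apply, ← he,
          H.quotMap_quotMap_apply, H.quotMap_quotMap_apply, inv_mul_cancel])
    refine ⟨V, i, hV, e * (H.quotMap hlm (le_refl m)).hom.app (op V) d, ?_⟩
    rw [map_mul, H.quotMap_quotMap_apply, hd, mul_inv_cancel_left]
  obtain ⟨e, rfl⟩ := key
  refine ⟨e, rfl, H.quotMap_injective hkl m' T ?_⟩
  rw [← hb, H.quotMap_quotMap_apply, H.quotMap_quotMap_apply]

end NormalSeries

namespace AQNormalSeries

variable {H : AQNormalSeries X}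

/-- The predecessor of the given index works: the ambient quotient is then two steps long, hence
abelian. -/
lemma isCentral (hH : H.HasAQDegree 2) : H.IsCentral := by
  rintro (_ | j) hj
  · exact absurd hj (lt_irrefl 0)
  · exact ⟨j, Nat.lt_succ_self j, fun U a b => hH j 2 one_le_two le_rfl U _ b⟩

lemma extension_shortExact (hH : H.HasAQDegree 2) (j : ℕ) : (H.extension hH j).ShortExact := by
  refine shortExact_of_sections (fun T => H.quotMap_injective (Nat.le_succ j) (j + 2) T)
    (fun T t ht => ?_) (fun T t => H.quotMap_exists_local_lift j (Nat.le_succ (j + 1)) t)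
  exact H.exists_quotMap_eq (Nat.le_succ j) (Nat.le_succ (j + 1)) t ht

end AQNormalSeries

/-! ## The first map of the primary complex -/

namespace AQNormalSeries

variable {H : AQNormalSeries X}

/-- Lifts to `H j / H (j + 2)` remain lifts after inclusion in `H k / H (j + 2)`, with the same
coboundary. -/
lemma isPrimaryOne_connecting (hH : H.HasAQDegree 2) {j k : ℕ} (hk : k < j + 1)
    (x : Sheaf.H (H.A j) 0) :
    H.IsPrimaryOne j k hk x (connecting (extension_shortExact hH j) 0 x) := by
  obtain ⟨γ, s, hs, hγ, h⟩ := exists_hasClass_connecting (H.aq (j + 1))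
    (extension_shortExact hH j) (globalSections (H.A j) x)
  rw [AddEquiv.symm_apply_apply] at h
  have hk' : k ≤ j := Nat.le_of_lt_succ hk
  refine ⟨γ, fun i => (H.quotMap hk' (le_refl (j + 2))).hom.app _
    (ofAdd (hH j 2 one_le_two le_rfl) (s i)), fun i => ?_, fun i i' T a b => ?_, h⟩
  · rw [H.quotMap_quotMap_apply, ← H.quotMap_quotMap_apply (le_refl j) (Nat.le_succ (j + 1)) hk'
      (le_refl (j + 1)), ← app_map_apply]
    exact congrArg _ (hs i)
  · rw [← app_map_apply, ← app_map_apply, ← map_inv, ← map_mul,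
      ← H.quotMap_quotMap_apply (Nat.le_succ j) (le_refl (j + 2)) hk' (le_refl (j + 2))]
    refine congrArg _ ((hγ i i' a b).trans ?_)
    exact sub_eq_add_neg _ _

/-- By the cartesian square, the lifts `g i` come from `H j / H (j + 2)`, so the given cocycle also
computes the abelian connecting homomorphism. -/
lemma IsPrimaryOne.eq_connecting (hH : H.HasAQDegree 2) {j k : ℕ} {hk : k < j + 1}
    {x : Sheaf.H (H.A j) 0} {y : Sheaf.H (H.A (j + 1)) 1} (h : H.IsPrimaryOne j k hk x y) :
    connecting (extension_shortExact hH j) 0 x = y := by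
  obtain ⟨γ, g, hg, hγ, hy⟩ := h
  have hk' : k ≤ j := Nat.le_of_lt_succ hk
  have key (i : γ.I) := H.exists_quotMap_eq_and hk' (Nat.le_succ j) (Nat.le_succ (j + 1)) (g i)
    ((H.quot j (j + 1)).obj.map (homOfLE le_top : γ.U i ⟶ ⊤).op
      (ofAdd (H.aq j) (globalSections (H.A j) x)))
    ((hg i).trans (app_map_apply _ _ _).symm)
  choose e heg hex using key
  have hE : IsAbelian (H.quot j (j + 2)) := hH j 2 one_le_two le_rfl
  refine IsCechClass.unique γ.covers (IsCechClassIn.isCechClass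
    (hS := extension_shortExact hH j) ⟨globalSections (H.A j) x, fun i => toAdd hE (e i), hex,
      fun i i' T a b => ?_, ?_⟩) hy fun i j T a b => rfl
  · have : (H.quotMap (Nat.le_succ j) (le_refl (j + 2))).hom.app (op T)
        (γ.toOneCocycle.ev i i' a b) = (H.quot j (j + 2)).obj.map a.op (e i) *
          ((H.quot j (j + 2)).obj.map b.op (e i'))⁻¹ := by
      refine H.quotMap_injective hk' (j + 2) T ?_
      rw [H.quotMap_quotMap_apply, map_mul, map_inv, app_map_apply, app_map_apply, heg, heg]
      exact hγ i i' a b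
    exact this.trans (sub_eq_add_neg (G := (additive _ hE).obj.obj (op T)) _ _).symm
  · exact (congrArg _ ((globalSections (H.A j)).symm_apply_apply x)).symm

end AQNormalSeries

/-! ## Comparison of connecting homomorphisms in degree `1` -/

lemma IsCechClass.cocycle {F : AbSheaf X} {I : Type u} {U : I → Opens X}
    {γ : ∀ (i j : I) ⦃T : Opens X⦄ (_ : T ⟶ U i) (_ : T ⟶ U j), F.obj.obj (op T)}
    {x : Sheaf.H F 1} (h : IsCechClass F U γ x) (i j k : I) ⦃T : Opens X⦄
    (a : T ⟶ U i) (b : T ⟶ U j) (c : T ⟶ U k) : γ i j a b + γ j k b c = γ i k a c := by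
  obtain ⟨J, Q, f, g, w, hS, q, s, hs, hγ, hx⟩ := h
  refine ShortExact.app_injective hS T ?_
  refine (map_add (f.hom.app (op T)).hom _ _).trans ?_
  refine (congrArg₂ (· + ·) (hγ i j a b) (hγ j k b c)).trans ?_
  refine Eq.trans ?_ (hγ i k a c).symm
  abel

/-- If the local lifts of a cocycle of `S.X₃` to `S.X₂` are mapped additively and equivariantly to
local lifts of a cocycle of `S'.X₃` to `S'.X₂`, then the classes of these cocycles have the same
image under the connecting homomorphisms. -/
lemma connecting_eq_of_lift {S S' : ShortComplex (AbSheaf X)} (hS : S.ShortExact)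
    (hS' : S'.ShortExact) (m : S.X₁ ⟶ S'.X₁) {I : Type u} {U : I → Opens X}
    (hU : ∀ x : X, ∃ i, x ∈ U i)
    {γ : ∀ (i j : I) ⦃T : Opens X⦄ (_ : T ⟶ U i) (_ : T ⟶ U j), S.X₃.obj.obj (op T)}
    {q : ∀ (i j : I) ⦃T : Opens X⦄ (_ : T ⟶ U i) (_ : T ⟶ U j), S'.X₃.obj.obj (op T)}
    {x : Sheaf.H S.X₃ 1} {z : Sheaf.H S'.X₃ 1}
    (hx : IsCechClass S.X₃ U γ x) (hz : IsCechClass S'.X₃ U q z)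
    (φ : ∀ (i j : I) ⦃T : Opens X⦄ (_ : T ⟶ U i) (_ : T ⟶ U j),
      S.X₂.obj.obj (op T) → S'.X₂.obj.obj (op T))
    (hres : ∀ (i j : I) ⦃T T' : Opens X⦄ (t : T' ⟶ T) (a : T ⟶ U i) (b : T ⟶ U j)
      (e : S.X₂.obj.obj (op T)), S.g.hom.app (op T) e = γ i j a b →
        φ i j (t ≫ a) (t ≫ b) (S.X₂.obj.map t.op e) = S'.X₂.obj.map t.op (φ i j a b e))
    (hequiv : ∀ (i j : I) ⦃T : Opens X⦄ (a : T ⟶ U i) (b : T ⟶ U j)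
      (α : S.X₁.obj.obj (op T)) (e : S.X₂.obj.obj (op T)),
      S.g.hom.app (op T) e = γ i j a b →
        φ i j a b (S.f.hom.app (op T) α + e) =
          S'.f.hom.app (op T) (m.hom.app (op T) α) + φ i j a b e)
    (hadd : ∀ (i j k : I) ⦃T : Opens X⦄ (a : T ⟶ U i) (b : T ⟶ U j) (d : T ⟶ U k)
      (e e' : S.X₂.obj.obj (op T)), S.g.hom.app (op T) e = γ i j a b →
        S.g.hom.app (op T) e' = γ j k b d →
          φ i k a d (e + e') = φ i j a b e + φ j k b d e')
    (hq : ∀ (i j : I) ⦃T : Opens X⦄ (a : T ⟶ U i) (b : T ⟶ U j) (e : S.X₂.obj.obj (op T)),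
      S.g.hom.app (op T) e = γ i j a b → S'.g.hom.app (op T) (φ i j a b e) = q i j a b) :
    Sheaf.H.map m 2 (connecting hS 1 x) = connecting hS' 1 z := by
  have hS₀ := injectiveSequence_shortExact S'.X₁
  -- Both sequences are mapped to one injective sequence, by extending `m` and the identity of
  -- `S'.X₁`.
  obtain ⟨ε, hε⟩ := exists_hom_injectiveSequence hS m
  obtain ⟨ε', hε'⟩ := exists_hom_injectiveSequence hS' (𝟙 S'.X₁)
  have h₁₂ (T : Opens X) (t : S.X₁.obj.obj (op T)) :
      ε.τ₂.hom.app (op T) (S.f.hom.app (op T) t) =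
        (Injective.ι S'.X₁).hom.app (op T) (m.hom.app (op T) t) := by
    rw [← hε]
    exact congrArg (fun ψ : S.X₁ ⟶ Injective.under S'.X₁ => ψ.hom.app (op T) t) ε.comm₁₂.symm
  have h₁₂' (T : Opens X) (t : S'.X₁.obj.obj (op T)) :
      ε'.τ₂.hom.app (op T) (S'.f.hom.app (op T) t) = (Injective.ι S'.X₁).hom.app (op T) t := by
    have h : S'.f ≫ ε'.τ₂ = Injective.ι S'.X₁ :=
      ε'.comm₁₂.symm.trans (by rw [hε']; exact Category.id_comp _)
    exact congrArg (fun ψ : S'.X₁ ⟶ Injective.under S'.X₁ => ψ.hom.app (op T) t) h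
  have h₂₃ (T : Opens X) (t : S.X₂.obj.obj (op T)) :
      (injectiveSequence S'.X₁).g.hom.app (op T) (ε.τ₂.hom.app (op T) t) =
        ε.τ₃.hom.app (op T) (S.g.hom.app (op T) t) :=
    congrArg (fun ψ : S.X₂ ⟶ (injectiveSequence S'.X₁).X₃ => ψ.hom.app (op T) t) ε.comm₂₃
  have h₂₃' (T : Opens X) (t : S'.X₂.obj.obj (op T)) :
      (injectiveSequence S'.X₁).g.hom.app (op T) (ε'.τ₂.hom.app (op T) t) =
        ε'.τ₃.hom.app (op T) (S'.g.hom.app (op T) t) :=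
    congrArg (fun ψ : S'.X₂ ⟶ (injectiveSequence S'.X₁).X₃ => ψ.hom.app (op T) t) ε'.comm₂₃
  have hlift (i j : I) ⦃T : Opens X⦄ (a : T ⟶ U i) (b : T ⟶ U j) : ∀ x ∈ T, ∃ (V : Opens X)
      (t : V ⟶ T), x ∈ V ∧ ∃ e, S.g.hom.app (op V) e = γ i j (t ≫ a) (t ≫ b) := by
    intro x hxT
    obtain ⟨V, t, hV, e, he⟩ := ShortExact.exists_local_lift hS (γ i j a b) x hxT
    exact ⟨V, t, hV, e, he.trans (hx.map_precomp i j t a b)⟩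
  have hlift_map (i j : I) ⦃T T' : Opens X⦄ (t : T' ⟶ T) (a : T ⟶ U i) (b : T ⟶ U j)
      (e : S.X₂.obj.obj (op T)) (he : S.g.hom.app (op T) e = γ i j a b) :
      S.g.hom.app (op T') (S.X₂.obj.map t.op e) = γ i j (t ≫ a) (t ≫ b) := by
    rw [app_map_apply, he, hx.map_precomp]
  -- Changing the lift `e` by `α` changes both terms of the difference by the image of `m α`, so the
  -- local differences glue.
  have key (i j : I) ⦃T : Opens X⦄ (a : T ⟶ U i) (b : T ⟶ U j) :=
    exists_glue (Injective.under S'.X₁) (T := T)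
      (fun V t s => ∃ e, S.g.hom.app (op V) e = γ i j (t ≫ a) (t ≫ b) ∧
        s = ε.τ₂.hom.app (op V) e - ε'.τ₂.hom.app (op V) (φ i j (t ≫ a) (t ≫ b) e))
      (by
        rintro V W t t' _ ⟨e, he, rfl⟩
        refine ⟨S.X₂.obj.map t'.op e, hlift_map i j t' _ _ e he, ?_⟩
        have := hres i j t' _ _ e he
        rw [map_sub, ← app_map_apply ε.τ₂.hom, ← app_map_apply ε'.τ₂.hom, ← this]
        rfl)
      (by
        rintro V t _ _ ⟨e, he, rfl⟩ ⟨e', he', rfl⟩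
        obtain ⟨α, hα⟩ := ShortExact.exists_app_eq hS (e' - e) (by rw [map_sub, he, he', sub_self])
        obtain rfl : e' = S.f.hom.app (op V) α + e := by rw [hα, sub_add_cancel]
        rw [hequiv i j _ _ α e he, map_add, map_add, h₁₂, h₁₂', add_sub_add_left_eq_sub])
      (fun x hxT => by
        obtain ⟨V, t, hV, e, he⟩ := hlift i j a b x hxT
        exact ⟨V, t, hV, _, e, he, rfl⟩)
  choose ψ hψ using key
  have hψ' (i j : I) ⦃T V : Opens X⦄ (t : V ⟶ T) (a : T ⟶ U i) (b : T ⟶ U j) (a' : V ⟶ U i)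
      (b' : V ⟶ U j) (e : S.X₂.obj.obj (op V)) (he : S.g.hom.app (op V) e = γ i j a' b') :
      (Injective.under S'.X₁).obj.map t.op (ψ i j a b) =
        ε.τ₂.hom.app (op V) e - ε'.τ₂.hom.app (op V) (φ i j a' b' e) :=
    hψ i j a b t _ ⟨e, he, rfl⟩
  obtain ⟨w, hw⟩ := exists_isCechClass (Injective.under S'.X₁) hU ψ
    (fun i j T T' t a b => by
      refine ext_of_local (Injective.under S'.X₁) fun x hxT => ?_
      obtain ⟨V, t', hV, e, he⟩ := hlift i j (t ≫ a) (t ≫ b) x hxT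
      refine ⟨V, t', hV, ?_⟩
      rw [map_map_apply, hψ' i j _ _ _ _ _ e he, hψ' i j _ _ _ _ _ e he])
    (fun i j k T a b c => by
      refine ext_of_local (Injective.under S'.X₁) fun x hxT => ?_
      obtain ⟨V, t, hV, e, he⟩ := hlift i j a b x hxT
      obtain ⟨V', t', hV', e', he'⟩ := hlift j k (t ≫ b) (t ≫ c) x hV
      have he₁ := hlift_map i j t' _ _ e he
      refine ⟨V', t' ≫ t, hV', ?_⟩
      have hsum : S.g.hom.app (op V') (S.X₂.obj.map t'.op e + e') =
          γ i k (t' ≫ t ≫ a) (t' ≫ t ≫ c) := by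
        rw [map_add, he₁, he', hx.cocycle]
      rw [map_add, hψ' i j _ _ _ _ _ _ he₁, hψ' j k _ _ _ _ _ _ he', hψ' i k _ _ _ _ _ _ hsum,
        hadd i j k _ _ _ _ _ he₁ he', map_add, map_add]
      abel)
  -- The cocycle `ψ` of the injective sheaf projects to the difference of the images of `γ` and `q`.
  -- That difference of classes therefore comes from the middle term, and the connecting
  -- homomorphism kills it.
  have hdiff := ((hx.map ε.τ₃).sub (hz.map ε'.τ₃)).unique hU
    (hw.map (injectiveSequence S'.X₁).g) fun i j T a b => by
      refine ext_of_local (injectiveSequence S'.X₁).X₃ fun x hxT => ?_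
      obtain ⟨V, t, hV, e, he⟩ := hlift i j a b x hxT
      refine ⟨V, t, hV, ?_⟩
      rw [← app_map_apply, hψ' i j _ _ _ _ _ _ he, map_sub, map_sub, ← app_map_apply,
        ← app_map_apply, hx.map_precomp, hz.map_precomp, ← he, ← hq i j _ _ _ he]
      exact congrArg₂ (· - ·) (h₂₃ V _).symm (h₂₃' V _).symm
  have h₀ := congrArg (connecting hS₀ 1) hdiff
  rw [connecting_map_g, map_sub, sub_eq_zero, ← connecting_naturality hS hS₀,
    ← connecting_naturality hS' hS₀, hε, hε'] at h₀
  exact h₀.trans (Sheaf.H.map_id_apply _)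

/-! ## Cohomologous cocycles -/

namespace CechCocycle

variable {F : GroupSheaf X}

lemma Cohomologous.refl (c : CechCocycle F) : c.Cohomologous c :=
  ⟨c.I, c.U, c.covers, id, fun _ => 𝟙 _, id, fun _ => 𝟙 _, fun _ => 1, fun k l T a b => by
    rw [map_one, map_one, one_mul, mul_one]⟩

lemma Cohomologous.symm {c d : CechCocycle F} (h : c.Cohomologous d) : d.Cohomologous c := by
  obtain ⟨K, W, hW, r, r', s, s', α, h⟩ := h
  refine ⟨K, W, hW, s, s', r, r', fun k => (α k)⁻¹, fun k l T a b => ?_⟩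
  rw [map_inv, map_inv, inv_mul_eq_iff_eq_mul, ← mul_assoc, eq_mul_inv_iff_mul_eq, ← h]

lemma Cohomologous.trans {c d e : CechCocycle F} (h : c.Cohomologous d) (h' : d.Cohomologous e) :
    c.Cohomologous e := by
  obtain ⟨K, W, hW, r, r', s, s', α, h⟩ := h
  obtain ⟨L, V, hV, t, t', v, v', β, h'⟩ := h'
  let l₁ (k : K × L) : W k.1 ⊓ V k.2 ⟶ W k.1 := homOfLE inf_le_left
  let l₂ (k : K × L) : W k.1 ⊓ V k.2 ⟶ V k.2 := homOfLE inf_le_right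
  -- The two refinements may select different indices for `d`; the middle factor, a value of `d`
  -- itself, mediates between them.
  refine ⟨K × L, fun k => W k.1 ⊓ V k.2, fun x => ?_, fun k => r k.1, fun k => l₁ k ≫ r' k.1,
    fun k => v k.2, fun k => l₂ k ≫ v' k.2, fun k => F.obj.map (l₂ k).op (β k.2) *
      d.toOneCocycle.ev (t k.2) (s k.1) (l₂ k ≫ t' k.2) (l₁ k ≫ s' k.1) *
      F.obj.map (l₁ k).op (α k.1), fun k l T a b => ?_⟩
  · obtain ⟨k, hk⟩ := hW x
    obtain ⟨l, hl⟩ := hV x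
    exact ⟨(k, l), hk, hl⟩
  · have h₁ := h k.1 l.1 (a ≫ l₁ k) (b ≫ l₁ l)
    have h₂ := h' k.2 l.2 (a ≫ l₂ k) (b ≫ l₂ l)
    simp only [map_mul, map_map_apply, d.toOneCocycle.ev_precomp, ← Category.assoc]
    rw [mul_assoc, h₁, ← mul_assoc, mul_assoc (F.obj.map (a ≫ l₂ k).op (β k.2)),
      d.toOneCocycle.ev_trans, ← mul_assoc (e.toOneCocycle.ev _ _ _ _),
      ← mul_assoc (e.toOneCocycle.ev _ _ _ _), ← h₂,
      mul_assoc _ (d.toOneCocycle.ev _ _ _ _) (d.toOneCocycle.ev _ _ _ _),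
      d.toOneCocycle.ev_trans, mul_assoc]

/-- `CechH1` is the quotient by a bare relation, so reading a cochain off an equality of classes
requires that relation to be an equivalence. -/
lemma cohomologous_of_class_eq {c d : CechCocycle F} (h : c.class = d.class) : c.Cohomologous d :=
  (Equivalence.quot_mk_eq_iff ⟨Cohomologous.refl, Cohomologous.symm, Cohomologous.trans⟩ c d).1 h

end CechCocycle

/-! ## Change of cocycle in the definition of the connecting map in degree `1` -/

/-- The family `φ` maps local lifts to `B` of the cocycle `c` of `C` to local lifts to `J` of the
family `q` of sections of `Q`, compatibly with restrictions, equivariantly for `A` and turning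
products into sums. -/
structure IsLiftMap {A B C : GroupSheaf X} (ι : A ⟶ B) (p : B ⟶ C) (hA : IsAbelian A)
    {J Q : AbSheaf X} (f : additive A hA ⟶ J) (g : J ⟶ Q) {I : Type u} (U : I → Opens X)
    (c : ∀ (i j : I) ⦃T : Opens X⦄ (_ : T ⟶ U i) (_ : T ⟶ U j), C.obj.obj (op T))
    (φ : ∀ (i j : I) ⦃T : Opens X⦄ (_ : T ⟶ U i) (_ : T ⟶ U j),
      B.obj.obj (op T) → J.obj.obj (op T))
    (q : ∀ (i j : I) ⦃T : Opens X⦄ (_ : T ⟶ U i) (_ : T ⟶ U j), Q.obj.obj (op T)) : Prop where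
  res : ∀ (i j : I) ⦃T T' : Opens X⦄ (t : T' ⟶ T) (a : T ⟶ U i) (b : T ⟶ U j)
    (β : B.obj.obj (op T)), p.hom.app (op T) β = c i j a b →
      φ i j (t ≫ a) (t ≫ b) (B.obj.map t.op β) = J.obj.map t.op (φ i j a b β)
  equiv : ∀ (i j : I) ⦃T : Opens X⦄ (a : T ⟶ U i) (b : T ⟶ U j)
    (α : A.obj.obj (op T)) (β : B.obj.obj (op T)),
    p.hom.app (op T) β = c i j a b →
      φ i j a b (ι.hom.app (op T) α * β) = f.hom.app (op T) (toAdd hA α) + φ i j a b β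
  mul : ∀ (i j k : I) ⦃T : Opens X⦄ (a : T ⟶ U i) (b : T ⟶ U j) (d : T ⟶ U k)
    (β β' : B.obj.obj (op T)), p.hom.app (op T) β = c i j a b →
      p.hom.app (op T) β' = c j k b d →
      φ i k a d (β * β') = φ i j a b β + φ j k b d β'
  proj : ∀ (i j : I) ⦃T : Opens X⦄ (a : T ⟶ U i) (b : T ⟶ U j)
    (β : B.obj.obj (op T)), p.hom.app (op T) β = c i j a b →
      g.hom.app (op T) (φ i j a b β) = q i j a b

/-- For a central extension, a map on lifts of a cocycle induces a map on lifts of a cohomologous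
cocycle, after passing to a refinement of the covering. -/
lemma IsLiftMap.exists_of_cohomologous {A B C : GroupSheaf X} {ι : A ⟶ B} {p : B ⟶ C}
    {hA : IsAbelian A} {J Q : AbSheaf X} {f : additive A hA ⟶ J} {g : J ⟶ Q}
    (hp : ∀ (T : Opens X) (t : C.obj.obj (op T)), ∀ x ∈ T,
      ∃ (V : Opens X) (i : V ⟶ T), x ∈ V ∧ ∃ s, p.hom.app (op V) s = C.obj.map i.op t)
    (hι : ∀ (T : Opens X) (α : A.obj.obj (op T)) (β : B.obj.obj (op T)),
      ι.hom.app (op T) α * β = β * ι.hom.app (op T) α)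
    {c d : CechCocycle C} (hcd : c.Cohomologous d)
    {φ : ∀ (i j : c.I) ⦃T : Opens X⦄ (_ : T ⟶ c.U i) (_ : T ⟶ c.U j),
      B.obj.obj (op T) → J.obj.obj (op T)}
    {q : ∀ (i j : c.I) ⦃T : Opens X⦄ (_ : T ⟶ c.U i) (_ : T ⟶ c.U j), Q.obj.obj (op T)}
    (hφ : IsLiftMap ι p hA f g c.U c.toOneCocycle.ev φ q) :
    ∃ (V : X → Opens X) (_ : ∀ x, x ∈ V x) (r : X → c.I) (r' : ∀ x, V x ⟶ c.U (r x))
      (s : X → d.I) (s' : ∀ x, V x ⟶ d.U (s x))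
      (φ' : ∀ (x y : X) ⦃T : Opens X⦄ (_ : T ⟶ V x) (_ : T ⟶ V y),
        B.obj.obj (op T) → J.obj.obj (op T)),
      IsLiftMap ι p hA f g V
        (fun x y _ a b => d.toOneCocycle.ev (s x) (s y) (a ≫ s' x) (b ≫ s' y)) φ'
        (fun x y _ a b => q (r x) (r y) (a ≫ r' x) (b ≫ r' y)) := by
  obtain ⟨K, W, hW, r, r', s, s', α, h⟩ := hcd
  choose k hk using hW
  -- The cochain `α` lifts to `B` only locally, so the covering is refined to one indexed by points.
  -- Then `β ↦ b x⁻¹ * β * b y` turns lifts of `d` into lifts of `c`.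
  choose V i hV b hb using fun x : X => hp (W (k x)) (α (k x)) x (hk x)
  have hlift (x y : X) ⦃T : Opens X⦄ (t : T ⟶ V x) (t' : T ⟶ V y) (β : B.obj.obj (op T))
      (hβ : p.hom.app (op T) β = d.toOneCocycle.ev (s (k x)) (s (k y)) (t ≫ i x ≫ s' (k x))
        (t' ≫ i y ≫ s' (k y))) :
      p.hom.app (op T) ((B.obj.map t.op (b x))⁻¹ * β * B.obj.map t'.op (b y)) =
        c.toOneCocycle.ev (r (k x)) (r (k y)) (t ≫ i x ≫ r' (k x)) (t' ≫ i y ≫ r' (k y)) := by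
    have := h (k x) (k y) (t ≫ i x) (t' ≫ i y)
    simp only [Category.assoc] at this
    rw [map_mul, map_mul, map_inv, app_map_apply, app_map_apply, hb, hb, map_map_apply,
      map_map_apply, hβ, mul_assoc, ← this, inv_mul_cancel_left]
  refine ⟨V, hV, fun x => r (k x), fun x => i x ≫ r' (k x), fun x => s (k x),
    fun x => i x ≫ s' (k x), fun x y T t t' β => φ _ _ (t ≫ i x ≫ r' (k x))
      (t' ≫ i y ≫ r' (k y)) ((B.obj.map t.op (b x))⁻¹ * β * B.obj.map t'.op (b y)), ?_⟩
  constructor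
  · intro x y T T' t a a' β hβ
    rw [← hφ.res _ _ t _ _ _ (hlift x y a a' β hβ)]
    simp only [map_mul, map_inv, map_map_apply, Category.assoc]
  -- Centrality moves the image of `γ` past the inverse of `b x`.
  · intro x y T a a' γ β hβ
    rw [← hφ.equiv _ _ _ _ γ _ (hlift x y a a' β hβ)]
    congr 1
    rw [← mul_assoc, ← hι, ← mul_assoc, ← mul_assoc]
  · intro x y z T a a' a'' β β' hβ hβ'
    rw [← hφ.mul _ _ _ _ _ _ _ _ (hlift x y a a' β hβ) (hlift y z a' a'' β' hβ')]
    congr 1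
    group
  · intro x y T a a' β hβ
    exact hφ.proj _ _ _ _ _ (hlift x y a a' β hβ)

/-! ## The second map of the primary complex -/

namespace AQNormalSeries

variable {H : AQNormalSeries X}

/-- The abelian extension itself serves as the embedding of `A (j + 1)`: all lifts lie in it, and
the map on lifts is the inverse of the inclusion. -/
lemma isPrimaryTwo_connecting (hH : H.HasAQDegree 2) {j k : ℕ} (hk : k < j + 1)
    (x : Sheaf.H (H.A j) 1) :
    H.IsPrimaryTwo j k hk x (connecting (extension_shortExact hH j) 1 x) := by
  obtain ⟨γ, hγ⟩ := exists_hasClass (H.aq j) x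
  have hk' : k ≤ j := Nat.le_of_lt_succ hk
  have hE : IsAbelian (H.quot j (j + 2)) := hH j 2 one_le_two le_rfl
  -- A total left inverse of the inclusion; its values off the image are arbitrary and are never
  -- evaluated on lifts.
  obtain ⟨ψ, hψ⟩ : ∃ ψ : ∀ T : Opens X, (H.quot k (j + 2)).obj.obj (op T) →
      (H.quot j (j + 2)).obj.obj (op T), ∀ (T : Opens X) (e : (H.quot j (j + 2)).obj.obj (op T)),
        ψ T ((H.quotMap hk' (le_refl (j + 2))).hom.app (op T) e) = e :=
    ⟨fun T => Function.invFun _, fun T =>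
      Function.leftInverse_invFun (H.quotMap_injective hk' (j + 2) T)⟩
  have hlift ⦃T : Opens X⦄ (a : (H.quot j (j + 1)).obj.obj (op T))
      (β : (H.quot k (j + 2)).obj.obj (op T))
      (hβ : (H.quotMap (le_refl k) (Nat.le_succ (j + 1))).hom.app (op T) β =
        (H.quotMap hk' (le_refl (j + 1))).hom.app (op T) a) :=
    H.exists_quotMap_eq_and hk' (Nat.le_succ j) (Nat.le_succ (j + 1)) β a hβ
  refine ⟨γ, hγ, _, rfl, (H.extension hH j).X₂, (H.extension hH j).X₃, (H.extension hH j).f,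
    (H.extension hH j).g, (H.extension hH j).zero, extension_shortExact hH j,
    fun i i' T a b β => toAdd hE (ψ T β),
    fun i i' T a b => toAdd (H.aq j) (γ.toOneCocycle.ev i i' a b), x,
    fun i i' T T' t a b β hβ => ?_, fun i i' T a b α β hβ => ?_,
    fun i i' i'' T a b d β β' hβ hβ' => ?_, fun i i' T a b β hβ => ?_, hγ, rfl⟩
  · obtain ⟨e, rfl, -⟩ := hlift _ β hβ
    refine congrArg (toAdd hE) (show ψ T' _ = (H.quot j (j + 2)).obj.map t.op (ψ T _) from ?_)
    rw [← app_map_apply, hψ, hψ]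
  · obtain ⟨e, rfl, -⟩ := hlift _ β hβ
    refine congrArg (toAdd hE) (show ψ T _ =
      (H.quotMap (Nat.le_succ j) (le_refl (j + 2))).hom.app (op T) α * ψ T _ from ?_)
    rw [← H.quotMap_quotMap_apply (Nat.le_succ j) (le_refl (j + 2)) hk' (le_refl (j + 2)),
      ← map_mul, hψ, hψ]
  · obtain ⟨e, rfl, -⟩ := hlift _ β hβ
    obtain ⟨e', rfl, -⟩ := hlift _ β' hβ'
    refine congrArg (toAdd hE) (show ψ T _ = ψ T _ * ψ T _ from ?_)
    rw [← map_mul, hψ, hψ, hψ]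
  · obtain ⟨e, rfl, he⟩ := hlift _ β hβ
    exact (congrArg (fun e => (H.extension hH j).g.hom.app (op T) (toAdd hE e)) (hψ T e)).trans he

/-- Centrality transfers the map on lifts from the representative `c` to the image of `γ`.
Restricted to `H j / H (j + 2)` it satisfies the hypotheses of `connecting_eq_of_lift`, with the
identity on `A (j + 1)`. -/
lemma IsPrimaryTwo.eq_connecting (hH : H.HasAQDegree 2) {j k : ℕ} {hk : k < j + 1}
    (hc : H.CentralAt k (j + 1) hk) {x : Sheaf.H (H.A j) 1} {y : Sheaf.H (H.A (j + 1)) 2}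
    (h : H.IsPrimaryTwo j k hk x y) : connecting (extension_shortExact hH j) 1 x = y := by
  obtain ⟨γ, hγ, c, hcγ, J, Q, f, g, w, hS, φ, q, z, hres, hequiv, hmul, hproj, hz, rfl⟩ := h
  have hk' : k ≤ j := Nat.le_of_lt_succ hk
  obtain ⟨V, hV, r, r', s, s', φ', hφ'⟩ := IsLiftMap.exists_of_cohomologous
    (fun T t => H.quotMap_exists_local_lift k (Nat.le_succ (j + 1)) t)
    (fun T α β => hc (op T) α β) (CechCocycle.cohomologous_of_class_eq hcγ)
    (IsLiftMap.mk hres hequiv hmul hproj)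
  have hE : IsAbelian (H.quot j (j + 2)) := hH j 2 one_le_two le_rfl
  have hlift (x y : X) ⦃T : Opens X⦄ (a : T ⟶ V x) (b : T ⟶ V y)
      (e : (H.quot j (j + 2)).obj.obj (op T))
      (he : (H.extension hH j).g.hom.app (op T) (toAdd hE e) =
        toAdd (H.aq j) (γ.toOneCocycle.ev (s x) (s y) (a ≫ s' x) (b ≫ s' y))) :
      (H.quotMap (le_refl k) (Nat.le_succ (j + 1))).hom.app (op T)
        ((H.quotMap hk' (le_refl (j + 2))).hom.app (op T) e) =
      (H.quotMap hk' (le_refl (j + 1))).hom.app (op T)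
        (γ.toOneCocycle.ev (s x) (s y) (a ≫ s' x) (b ≫ s' y)) := by
    rw [H.quotMap_quotMap_apply, ← H.quotMap_quotMap_apply (le_refl j) (Nat.le_succ (j + 1)) hk'
      (le_refl (j + 1))]
    exact congrArg _ he
  have key := connecting_eq_of_lift (extension_shortExact hH j) hS (𝟙 _) (fun x => ⟨x, hV x⟩)
    (IsCechClass.refine hγ s s') (hz.refine r r')
    (fun x y T a b e => φ' x y a b ((H.quotMap hk' (le_refl (j + 2))).hom.app (op T) (ofAdd hE e)))
    (fun x y T T' t a b e he => ?_) (fun x y T a b α e he => ?_)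
    (fun x y z T a b d e e' he he' => ?_)
    (fun x y T a b e he => hφ'.proj x y a b _ (hlift x y a b e he))
  · exact (Sheaf.H.map_id_apply _).symm.trans key
  · refine Eq.trans ?_ (hφ'.res x y t a b _ (hlift x y a b e he))
    exact congrArg _ (app_map_apply (H.quotMap hk' (le_refl (j + 2))).hom t (ofAdd hE e))
  · refine Eq.trans ?_ (hφ'.equiv x y a b (ofAdd (H.aq (j + 1)) α) _ (hlift x y a b e he))
    refine congrArg _ ((map_mul ((H.quotMap hk' (le_refl (j + 2))).hom.app (op T)).hom
      ((H.quotMap (Nat.le_succ j) (le_refl (j + 2))).hom.app (op T) (ofAdd (H.aq (j + 1)) α))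
      (ofAdd hE e)).trans (congrArg (· * _) ?_))
    exact H.quotMap_quotMap_apply _ _ _ _ _
  · refine Eq.trans ?_ (hφ'.mul x y z a b d _ _ (hlift x y a b e he) (hlift y z b d e' he'))
    exact congrArg _ (map_mul ((H.quotMap hk' (le_refl (j + 2))).hom.app (op T)).hom
      (ofAdd hE e) (ofAdd hE e'))

end AQNormalSeries

/-! ## The primary complex -/

namespace AQNormalSeries

variable {H : AQNormalSeries X}

/-- The sheaf `H j / H (j + 3)` need not be abelian, but the quotients of local lifts of `x` to it
lie in `H (j + 1) / H (j + 3)`, which is. So the first image lifts to a class of the middle term of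
the next extension, and exactness kills it. -/
lemma connecting_connecting (hH : H.HasAQDegree 2) (j : ℕ) (x : Sheaf.H (H.A j) 0) :
    connecting (extension_shortExact hH (j + 1)) 1
      (connecting (extension_shortExact hH j) 0 x) = 0 := by
  have hE : IsAbelian (H.quot j (j + 2)) := hH j 2 one_le_two le_rfl
  have hE' : IsAbelian (H.quot (j + 1) (j + 3)) := hH (j + 1) 2 one_le_two le_rfl
  let q : (H.quot j (j + 1)).obj.obj (op ⊤) := ofAdd (H.aq j) (globalSections (H.A j) x)
  have hj : j + 1 ≤ j + 3 := by lia
  choose U i hU b hb using fun x : X => H.quotMap_exists_local_lift j hj (T := ⊤) q x trivial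
  have key (x y : X) ⦃T : Opens X⦄ (s : T ⟶ U x) (t : T ⟶ U y) :=
    H.exists_quotMap_eq (Nat.le_succ j) hj
      ((H.quot j (j + 3)).obj.map s.op (b x) * ((H.quot j (j + 3)).obj.map t.op (b y))⁻¹) (by
        rw [map_mul, map_inv, app_map_apply, app_map_apply, hb, hb, map_map_apply, map_map_apply,
          Subsingleton.elim (s ≫ i x) (t ≫ i y), mul_inv_cancel])
  choose ψ hψ using key
  have hinj := H.quotMap_injective (Nat.le_succ j) (j + 3)
  obtain ⟨w, hw⟩ := exists_isCechClass (additive (H.quot (j + 1) (j + 3)) hE')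
    (U := U) (fun x => ⟨x, hU x⟩) (fun x y T s t => toAdd hE' (ψ x y s t))
    (fun x y T T' r s t => by
      refine congrArg (toAdd hE')
        (show (H.quot (j + 1) (j + 3)).obj.map r.op (ψ x y s t) = _ from hinj _ ?_)
      rw [app_map_apply, hψ, hψ, map_mul, map_inv, map_map_apply, map_map_apply])
    (fun x y z T r s t => by
      refine congrArg (toAdd hE') (show ψ x y r s * ψ y z s t = _ from hinj _ ?_)
      rw [map_mul, hψ, hψ, hψ, mul_assoc, inv_mul_cancel_left])
  have hx : IsCechClass (H.A (j + 1)) U (fun x y T s t =>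
      (H.extension hH (j + 1)).g.hom.app (op T) (toAdd hE' (ψ x y s t)))
      (connecting (extension_shortExact hH j) 0 x) := by
    refine IsCechClassIn.isCechClass (hS := extension_shortExact hH j)
      ⟨globalSections (H.A j) x, fun y => toAdd hE
        ((H.quotMap (le_refl j) (Nat.le_succ (j + 2))).hom.app (op (U y)) (b y)), fun y => ?_,
        fun y z T s t => ?_, ?_⟩
    · refine (H.quotMap_quotMap_apply (le_refl j) (Nat.le_succ (j + 2)) (le_refl j)
        (Nat.le_succ (j + 1)) (b y)).trans ((hb y).trans ?_)
      rfl
    · have : (H.quotMap (Nat.le_succ j) (le_refl (j + 2))).hom.app (op T)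
          ((H.quotMap (le_refl (j + 1)) (Nat.le_succ (j + 2))).hom.app (op T) (ψ y z s t)) =
          (H.quot j (j + 2)).obj.map s.op
            ((H.quotMap (le_refl j) (Nat.le_succ (j + 2))).hom.app (op (U y)) (b y)) *
          ((H.quot j (j + 2)).obj.map t.op
            ((H.quotMap (le_refl j) (Nat.le_succ (j + 2))).hom.app (op (U z)) (b z)))⁻¹ := by
        rw [H.quotMap_quotMap_apply, ← app_map_apply, ← app_map_apply, ← map_inv, ← map_mul,
          ← hψ, H.quotMap_quotMap_apply]
      exact this.trans (sub_eq_add_neg (G := (additive _ hE).obj.obj (op T)) _ _).symm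
    · exact (congrArg _ ((globalSections (H.A j)).symm_apply_apply x)).symm
  rw [hx.unique (fun x => ⟨x, hU x⟩) (hw.map (H.extension hH (j + 1)).g) fun _ _ _ _ _ => rfl]
  exact connecting_map_g (extension_shortExact hH (j + 1)) 1 w

lemma isLinearOver_connecting (hH : H.HasAQDegree 2) {K : Type v} [Ring K] (σ : H.Scalars hH K)
    (j n : ℕ) : IsLinearOver (σ.onA j) (σ.onA (j + 1))
      (connecting (extension_shortExact hH j) n) := by
  -- A scalar acts as an endomorphism of the whole extension, so its compatibility with the
  -- connecting map is naturality.
  let φ (r : K) : H.extension hH j ⟶ H.extension hH j :=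
    ⟨σ.onA (j + 1) r, σ.onE j r, σ.onA j r, σ.f_comm j r, σ.g_comm j r⟩
  let := cohomologyModule (σ.onA j) n
  let := cohomologyModule (σ.onA (j + 1)) (n + 1)
  exact IsLinearMap.mk (map_add _) fun r x => (connecting_naturality (extension_shortExact hH j)
    (extension_shortExact hH j) (φ r) n x).symm

end AQNormalSeries

end AQ

theorem mainTheorem5 (X : TopCat.{u}) (H : AQ.AQNormalSeries X) (hH : H.HasAQDegree 2) :
    H.IsCentral ∧
    ∃ (hE : ∀ j, (H.extension hH j).ShortExact)
      (d₁ : ∀ j, Sheaf.H (H.A j) 0 →+ Sheaf.H (H.A (j + 1)) 1)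
      (d₂ : ∀ j, Sheaf.H (H.A j) 1 →+ Sheaf.H (H.A (j + 1)) 2),
      (∀ (j k : ℕ) (hk : k < j + 1), H.CentralAt k (j + 1) hk →
        (∀ x y, H.IsPrimaryOne j k hk x y ↔ d₁ j x = y) ∧
        (∀ x y, H.IsPrimaryTwo j k hk x y ↔ d₂ j x = y)) ∧
      (∀ j x, d₂ (j + 1) (d₁ j x) = 0) ∧
      (∀ j, d₁ j = AQ.connecting (hE j) 0 ∧ d₂ j = AQ.connecting (hE j) 1) ∧
      (∀ (K : Type v) [Ring K] (σ : H.Scalars hH K) (j : ℕ),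
        AQ.IsLinearOver (σ.onA j) (σ.onA (j + 1)) (d₁ j) ∧
        AQ.IsLinearOver (σ.onA j) (σ.onA (j + 1)) (d₂ j)) := by
  refine ⟨AQ.AQNormalSeries.isCentral hH, AQ.AQNormalSeries.extension_shortExact hH,
    fun j => AQ.connecting (AQ.AQNormalSeries.extension_shortExact hH j) 0,
    fun j => AQ.connecting (AQ.AQNormalSeries.extension_shortExact hH j) 1,
    fun j k hk hc => ⟨fun x y => ⟨fun h => h.eq_connecting hH, ?_⟩,
      fun x y => ⟨fun h => h.eq_connecting hH hc, ?_⟩⟩,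
    AQ.AQNormalSeries.connecting_connecting hH, fun j => ⟨rfl, rfl⟩,
    fun K _ σ j => ⟨AQ.AQNormalSeries.isLinearOver_connecting hH σ j 0,
      AQ.AQNormalSeries.isLinearOver_connecting hH σ j 1⟩⟩
  · rintro rfl
    exact AQ.AQNormalSeries.isPrimaryOne_connecting hH hk x
  · rintro rfl
    exact AQ.AQNormalSeries.isPrimaryTwo_connecting hH hk x
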